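/- Let $\sigma>0$, weights $\alpha_1,\dots,\alpha_K>0$, channels $h_1,\dots,h_K\in\mathbb C^N$, $P_A\ge 0$, and let $A\in\mathbb C^{N\times N}$ be positive semidefinite of rank $m\le N$ with $\mathrm{Null}(A)\subseteq \mathrm{Null}\big(\sum_i h_ih_i^H\big)$. Let $A=[U_1,U_2]\Lambda[U_1,U_2]^H$ be a singular value decomposition, $[U_1,U_2]$ unitary, where $U_1\in\mathbb C^{N\times m}$ and $U_2\in\mathbb C^{N\times(N-m)}$ belong to the non-zero and to the zero singular values. For a permutation $\pi$ of $\{1,\dots,K\}$ (an encoding order) let $\mathcal C_\pi(\{S_i\},\{h_i\})$ be the set of $r\in\mathbb R_{\ge0}^K$ with $$r_{\pi(i)}\le\log_2\frac{\sigma^2+h_{\pi(i)}^H\big(\sum_{k\ge i}S_{\pi(k)}\big)h_{\pi(i)}}{\sigma^2+h_{\pi(i)}^H\big(\sum_{k> i}S_{\pi(k)}\big)h_{\pi(i)}}\quad\text{for all } i,$$ and let $\mathcal C_{\rm BC}=\bigcup_\pi\mathcal C_\pi$. Consider the problem $$\text{(I)}\quad \max_{\{S_i\},r}\ \sum_i\alpha_ir_i\quad\text{s.t.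 } r\in\mathcal C_{\rm BC}(\{S_i\},\{h_i\}),\ \ \sum_i\mathrm{Tr}(AS_i)\le P_A,\ \ S_i\succeq0,$$ and the reduced problem (II): the same problem for matrices $B_i\in\mathbb C^{m\times m}$, with $h_i$, $A$ replaced by $\hat h_i=U_1^Hh_i$, $\hat A=U_1^HAU_1$. Then: 1. $\hat A$ is positive definite and (II) has an optimal solution. 2. $(\{\bar S_i\},r)$ is optimal for (I) if and only if there are an optimal solution $(\{\bar B_i\},r)$ of (II) and matrices $\bar C_i\in\mathbb C^{m\times(N-m)}$, $\bar D_i\in\mathbb C^{(N-m)\times(N-m)}$ such that for all $i$ $$\bar S_i=U_1\bar B_iU_1^H+U_1\bar C_iU_2^H+U_2\bar C_i^HU_1^H+U_2\bar D_iU_2^H\quad\text{and}\quad \bar S_i\succeq0 .$$ (So $\bar C_i,\bar D_i$ are arbitrary subject to $\bar S_i\succeq 0$.) 3. If not all $h_i$ vanish and the weights $\alpha_i$ are pairwise distinct, then the optimal solution $(\{\bar B_i\},r)$ of (II) is unique. If weights may coincide, but for every value $c$ the matrices $\hat h_i\hat h_i^H$ with $\alpha_i=c$ are linearly independent over $\mathbb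 R$, then for every encoding order $\pi$ with $\alpha_{\pi(1)}\ge\dots\ge\alpha_{\pi(K)}$ the problem (II) with $\mathcal C_\pi$ in place of $\mathcal C_{\rm BC}$ has a unique optimal solution. 4. If not all $h_i$ vanish, then $\mathrm{rank}(\bar B_i)\le1$ for all $i$ in every optimal solution of (II). 5. (BC–MAC duality.) Let $\pi$ satisfy $\alpha_{\pi(1)}\ge\dots\ge\alpha_{\pi(K)}$. For $p\in\mathbb R_{\ge0}^K$ put $M_i(p)=\hat A+\sum_{k\le i}p_{\pi(k)}\hat h_{\pi(k)}\hat h_{\pi(k)}^H$ for $0\le i\le K$, and $r^{(m)}_{\pi(i)}(p)=\log_2\frac{\det M_i(p)}{\det M_{i-1}(p)}$. The problem of maximizing $\sum_i\alpha_ir_i^{(m)}(p)$ subject to $p\ge0$, $\sigma^2\sum_ip_i\le P_A$ has an optimal solution. For each of its optimal solutions $p$, let $v_{\pi(i)}$ be the vector $M_{i-1}(p)^{-1}\hat h_{\pi(i)}$ divided by its Euclidean norm; then there is $q\in\mathbb R_{\ge0}^K$ with $$q_{\pi(i)}=\frac{2^{r^{(m)}_{\pi(i)}(p)}-1}{|\hat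 h_{\pi(i)}^Hv_{\pi(i)}|^2}\Big(\sum_{k>i}q_{\pi(k)}|\hat h_{\pi(i)}^Hv_{\pi(k)}|^2+\sigma^2\Big)\quad\text{for all } i$$ (with $v_j=0$, $q_j=0$ if $\hat h_j=0$), the rates $r^{(m)}(p)$ lie in $\mathcal C_\pi(\{\bar B_i\},\{\hat h_i\})$ for $\bar B_i=w_iw_i^H$, $w_i=\sqrt{q_i}\,v_i$, and $(\{\bar B_i\},r^{(m)}(p))$ is an optimal solution of (II). -/

import Mathlib

open scoped ComplexOrder

noncomputable section

namespace MISOBC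

open Matrix

variable {ι : Type*} [Fintype ι] {K : ℕ}

/-- The received power `hᴴ S h` of a signal with covariance `S` over the channel `h`
(a real number for Hermitian `S`). -/
def rxPower (h : ι → ℂ) (S : Matrix ι ι ℂ) : ℝ :=
  (star h ⬝ᵥ (S *ᵥ h)).re

/-- The dirty-paper-coding rate (in bps/Hz) of the `i`-th encoded user, that is of user `π i`,
for the encoding order `π` and noise power `nv`: only the users encoded later interfere. -/
def dpcRate (nv : ℝ) (h : Fin K → ι → ℂ) (S : Fin K → Matrix ι ι ℂ)
    (π : Equiv.Perm (Fin K)) (i : Fin K) : ℝ :=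
  Real.logb 2
    ((nv + rxPower (h (π i)) (∑ k ∈ Finset.Ici i, S (π k))) /
      (nv + rxPower (h (π i)) (∑ k ∈ Finset.Ioi i, S (π k))))

/-- The rate tuples achievable with the fixed encoding order `π`. -/
def orderRegion (nv : ℝ) (h : Fin K → ι → ℂ) (π : Equiv.Perm (Fin K))
    (S : Fin K → Matrix ι ι ℂ) : Set (Fin K → ℝ) :=
  {r | (∀ i, 0 ≤ r i) ∧ ∀ i, r (π i) ≤ dpcRate nv h S π i}

/-- The achievable rate region `C_BC({S_i}, {h_i})`: the union over all encoding orders. -/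
def bcRegion (nv : ℝ) (h : Fin K → ι → ℂ) (S : Fin K → Matrix ι ι ℂ) : Set (Fin K → ℝ) :=
  ⋃ π : Equiv.Perm (Fin K), orderRegion nv h π S

/-- The feasible points `({S_i}, r)` of the weighted sum-rate problem with the rate region `C`
and the single constraint `∑ i, Tr (A S_i) ≤ P`. -/
def wsrFeasible (C : (Fin K → Matrix ι ι ℂ) → Set (Fin K → ℝ)) (A : Matrix ι ι ℂ) (P : ℝ) :
    Set ((Fin K → Matrix ι ι ℂ) × (Fin K → ℝ)) :=
  {x | x.2 ∈ C x.1 ∧ (∑ i, (A * x.1 i).trace).re ≤ P ∧ ∀ i, (x.1 i).PosSemidef}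

/-- `({S_i}, r)` maximizes `∑ i, α_i r_i` over the feasible points. -/
def IsWsrOptimal (α : Fin K → ℝ) (C : (Fin K → Matrix ι ι ℂ) → Set (Fin K → ℝ))
    (A : Matrix ι ι ℂ) (P : ℝ) (x : (Fin K → Matrix ι ι ℂ) × (Fin K → ℝ)) : Prop :=
  x ∈ wsrFeasible C A P ∧ IsMaxOn (fun y => ∑ i, α i * y.2 i) (wsrFeasible C A P) x

/-- `A = [U₁, U₂] Λ [U₁, U₂]ᴴ` with `[U₁, U₂]` unitary and `Λ` diagonal, where the diagonal
entries that belong to `U₁` are positive and those that belong to `U₂` vanish. -/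
def IsSplitSVD {μ ν : Type*} [Fintype μ] [Fintype ν] [DecidableEq ι] [DecidableEq μ]
    [DecidableEq ν] (A : Matrix ι ι ℂ) (U₁ : Matrix ι μ ℂ) (U₂ : Matrix ι ν ℂ) : Prop :=
  fromCols U₁ U₂ * (fromCols U₁ U₂).conjTranspose = 1 ∧
  (fromCols U₁ U₂).conjTranspose * fromCols U₁ U₂ = 1 ∧
  ∃ d : μ → ℝ, (∀ i, 0 < d i) ∧
    A = fromCols U₁ U₂ *
      (diagonal (Sum.elim (fun i => (d i : ℂ)) (fun _ => 0)) : Matrix (μ ⊕ ν) (μ ⊕ ν) ℂ) *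
      (fromCols U₁ U₂).conjTranspose

/-! ### The dual multiple access channel -/

/-- The matrix `A + ∑ k ∈ s, p_{π k} h_{π k} h_{π k}ᴴ`: noise plus the signals of the users
at the positions in `s`. -/
def macCov (A : Matrix ι ι ℂ) (h : Fin K → ι → ℂ) (π : Equiv.Perm (Fin K)) (p : Fin K → ℝ)
    (s : Finset (Fin K)) : Matrix ι ι ℂ :=
  A + ∑ k ∈ s, (p (π k) : ℂ) • vecMulVec (h (π k)) (star (h (π k)))

/-- The dual MAC rate of user `π i`, who is decoded in the presence of the users at the earlier
positions. -/
def macRateAt [DecidableEq ι] (A : Matrix ι ι ℂ) (h : Fin K → ι → ℂ) (π : Equiv.Perm (Fin K))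
    (p : Fin K → ℝ) (i : Fin K) : ℝ :=
  Real.logb 2
    ((macCov A h π p (Finset.Iic i)).det.re / (macCov A h π p (Finset.Iio i)).det.re)

/-- The tuple of dual MAC rates, indexed by the users. -/
def macRate [DecidableEq ι] (A : Matrix ι ι ℂ) (h : Fin K → ι → ℂ) (π : Equiv.Perm (Fin K))
    (p : Fin K → ℝ) (j : Fin K) : ℝ :=
  macRateAt A h π p (π.symm j)

/-- The feasible powers of the dual MAC: `p_i ≥ 0` and `nv * ∑ i, p_i ≤ P`. -/
def macFeasible (K : ℕ) (nv P : ℝ) : Set (Fin K → ℝ) :=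
  {p | (∀ i, 0 ≤ p i) ∧ nv * ∑ i, p i ≤ P}

/-- `p` maximizes the weighted sum rate of the dual MAC. -/
def IsMacOptimal [DecidableEq ι] (α : Fin K → ℝ) (nv : ℝ) (A : Matrix ι ι ℂ)
    (h : Fin K → ι → ℂ) (P : ℝ) (π : Equiv.Perm (Fin K)) (p : Fin K → ℝ) : Prop :=
  p ∈ macFeasible K nv P ∧
    IsMaxOn (fun p' => ∑ j, α j * macRate A h π p' j) (macFeasible K nv P) p

/-- The normalized MMSE receive beamformer of user `j` in the dual MAC
(zero if the channel of `j` is zero). -/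
def mmseBeam [DecidableEq ι] (A : Matrix ι ι ℂ) (h : Fin K → ι → ℂ) (π : Equiv.Perm (Fin K))
    (p : Fin K → ℝ) (j : Fin K) : ι → ℂ :=
  let u : ι → ℂ := (macCov A h π p (Finset.Iio (π.symm j)))⁻¹ *ᵥ h j
  ((‖WithLp.toLp 2 u‖⁻¹ : ℝ) : ℂ) • u

/-- `q` solves the triangular system of downlink powers: with the beamformers of the dual MAC,
every user obtains in the broadcast channel its dual MAC rate. -/
def IsDownlinkPower [DecidableEq ι] (nv : ℝ) (A : Matrix ι ι ℂ) (h : Fin K → ι → ℂ)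
    (π : Equiv.Perm (Fin K)) (p q : Fin K → ℝ) : Prop :=
  ∀ i, q (π i) =
    ((2 : ℝ) ^ macRateAt A h π p i - 1) / ‖star (h (π i)) ⬝ᵥ mmseBeam A h π p (π i)‖ ^ 2 *
      (∑ k ∈ Finset.Ioi i, q (π k) * ‖star (h (π i)) ⬝ᵥ mmseBeam A h π p (π k)‖ ^ 2 + nv)

/-- The covariance `w_j w_jᴴ` with `w_j = √q_j v_j`, where `v_j` is the MMSE beamformer. -/
def beamCov [DecidableEq ι] (A : Matrix ι ι ℂ) (h : Fin K → ι → ℂ) (π : Equiv.Perm (Fin K))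
    (p q : Fin K → ℝ) (j : Fin K) : Matrix ι ι ℂ :=
  let w : ι → ℂ := ((Real.sqrt (q j) : ℝ) : ℂ) • mmseBeam A h π p j
  vecMulVec w (star w)

end MISOBC

end

/-!
The MMSE receivers of the dual multiple access channel turn a broadcast point into multiple access
powers `p` with the same rates through a triangular linear system, and back again. Here
`nv * ∑ i, p i` is at most the weighted trace `∑ i, Tr (A S_i)`, with equality only for the rank-one
covariances obtained from the MMSE beamformers, so both problems have the same optimal value and
the covariances of an optimal broadcast point are determined by `p`.

In the multiple access channel, the sum rate `log₂ (det (A + ∑ k ∈ T, p_k h_k h_kᴴ) / det A)` is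
submodular in the set `T` of users. By Abel summation, encoding in the order of decreasing weights
is therefore best, and it turns the weighted sum rate into a nonnegative combination of logarithms
of determinants, whose strict concavity gives uniqueness.

Finally, `U₁` compresses the full problem to the reduced one: the channels lie in the range of `U₁`,
so neither rates nor weighted traces see the other blocks of the covariances.
-/

open scoped ComplexOrder

namespace MISOBC

open Matrix

section MatrixInequalities

open scoped MatrixOrder

variable {𝕜 n : Type*} [RCLike 𝕜] [Fintype n]

lemma exists_eq_conjTranspose_mul_self {M : Matrix n n 𝕜} (hM : M.PosSemidef) :
    ∃ C : Matrix n n 𝕜, M = Cᴴ * C := by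
  classical
  exact CStarAlgebra.nonneg_iff_eq_star_mul_self.1 (nonneg_iff_posSemidef.2 hM)

lemma trace_mul_nonneg {M N : Matrix n n 𝕜} (hM : M.PosSemidef) (hN : N.PosSemidef) :
    0 ≤ (M * N).trace := by
  obtain ⟨C, rfl⟩ := exists_eq_conjTranspose_mul_self hN
  rw [← Matrix.mul_assoc, trace_mul_comm, ← Matrix.mul_assoc]
  exact (hM.mul_mul_conjTranspose_same C).trace_nonneg

lemma re_trace_mul_nonneg {M N : Matrix n n 𝕜} (hM : M.PosSemidef) (hN : N.PosSemidef) :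
    0 ≤ RCLike.re (M * N).trace :=
  (RCLike.nonneg_iff.1 (trace_mul_nonneg hM hN)).1

lemma mul_eq_zero_of_re_trace_mul_eq_zero {M N : Matrix n n 𝕜} (hM : M.PosSemidef)
    (hN : N.PosSemidef) (h0 : RCLike.re (M * N).trace = 0) : M * N = 0 := by
  have htr : (M * N).trace = 0 :=
    RCLike.ext (by simpa using h0) (by simpa using (RCLike.nonneg_iff.1 (trace_mul_nonneg hM hN)).2)
  obtain ⟨C, rfl⟩ := exists_eq_conjTranspose_mul_self hN
  obtain ⟨D, rfl⟩ := exists_eq_conjTranspose_mul_self hM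
  have hDC : D * Cᴴ = 0 := by
    rw [← trace_conjTranspose_mul_self_eq_zero_iff, ← htr, conjTranspose_mul,
      conjTranspose_conjTranspose, Matrix.mul_assoc, trace_mul_comm]
    simp only [Matrix.mul_assoc]
  rw [Matrix.mul_assoc, ← Matrix.mul_assoc D, hDC, Matrix.zero_mul, Matrix.mul_zero]

variable [DecidableEq n]

lemma re_det_pos {M : Matrix n n 𝕜} (hM : M.PosDef) : 0 < RCLike.re M.det :=
  (RCLike.pos_iff.1 hM.det_pos).1

lemma coe_re_det {M : Matrix n n 𝕜} (hM : M.PosDef) : (RCLike.re M.det : 𝕜) = M.det :=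
  RCLike.ext (by simp) (by simp [(RCLike.pos_iff.1 hM.det_pos).2])

lemma log_det_lt_trace_sub_card {Z : Matrix n n 𝕜} (hZ : Z.PosDef) (hZ1 : Z ≠ 1) :
    Real.log (RCLike.re Z.det) < RCLike.re Z.trace - Fintype.card n := by
  set e := hZ.1.eigenvalues with he
  have hpos : ∀ i, 0 < e i := hZ.eigenvalues_pos
  have hdet : RCLike.re Z.det = ∏ i, e i := by
    rw [hZ.1.det_eq_prod_eigenvalues, ← RCLike.ofReal_prod, RCLike.ofReal_re]
  have htrace : RCLike.re Z.trace = ∑ i, e i := by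
    rw [hZ.1.trace_eq_sum_eigenvalues, ← RCLike.ofReal_sum, RCLike.ofReal_re]
  obtain ⟨j, hj⟩ : ∃ j, e j ≠ 1 := by
    by_contra! hone
    have hdiag : (RCLike.ofReal ∘ hZ.1.eigenvalues : n → 𝕜) = fun _ => 1 :=
      funext fun i => by simp [← he, hone i]
    refine hZ1 ?_
    rw [hZ.1.spectral_theorem, hdiag, diagonal_one, map_one]
  have hsum : ∑ i, Real.log (e i) < ∑ i, (e i - 1) :=
    Finset.sum_lt_sum (fun i _ => Real.log_le_sub_one_of_pos (hpos i))
      ⟨j, Finset.mem_univ j, Real.log_lt_sub_one_of_pos (hpos j) hj⟩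
  simpa [hdet, htrace, Real.log_prod fun i _ => (hpos i).ne'] using hsum

lemma log_det_lt_tangent {X Y : Matrix n n 𝕜} (hX : X.PosDef) (hY : Y.PosDef) (hne : Y ≠ X) :
    Real.log (RCLike.re Y.det)
      < Real.log (RCLike.re X.det) + RCLike.re (X⁻¹ * (Y - X)).trace := by
  obtain ⟨C, hC⟩ := exists_eq_conjTranspose_mul_self hX.inv.posSemidef
  have hXu : IsUnit X.det := (isUnit_iff_isUnit_det X).1 hX.isUnit
  have hCu : IsUnit C := by
    have : IsUnit (Cᴴ * C).det := by rw [← hC]; exact (isUnit_iff_isUnit_det _).1 hX.inv.isUnit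
    rw [det_mul] at this
    exact (isUnit_iff_isUnit_det _).2 (isUnit_of_mul_isUnit_right this)
  have hZ : (C * Y * Cᴴ).PosDef := (IsUnit.posDef_star_right_conjugate_iff hCu).2 hY
  have hZ1 : C * Y * Cᴴ ≠ 1 := fun hone => hne <| by
    have hXY : X⁻¹ * Y = 1 := by
      rw [hC, Matrix.mul_assoc, mul_eq_one_comm]; exact hone
    rw [← mul_nonsing_inv_cancel_left X Y hXu, hXY, Matrix.mul_one]
  have htrace : RCLike.re (C * Y * Cᴴ).trace - Fintype.card n
      = RCLike.re (X⁻¹ * (Y - X)).trace := by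
    rw [Matrix.mul_sub, nonsing_inv_mul X hXu, trace_sub, trace_one, trace_mul_comm,
      ← Matrix.mul_assoc, ← hC]
    simp
  have hdet : RCLike.re (C * Y * Cᴴ).det = RCLike.re Y.det / RCLike.re X.det := by
    rw [Matrix.mul_assoc, det_mul_comm, Matrix.mul_assoc, ← hC, det_mul, det_nonsing_inv,
      Ring.inverse_eq_inv', ← coe_re_det hX, ← coe_re_det hY, ← div_eq_mul_inv,
      ← RCLike.ofReal_div]
    simp only [RCLike.ofReal_re]
  have := log_det_lt_trace_sub_card hZ hZ1
  rw [htrace, hdet, Real.log_div (re_det_pos hY).ne' (re_det_pos hX).ne'] at this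
  linarith

lemma log_det_le_tangent {X Y : Matrix n n 𝕜} (hX : X.PosDef) (hY : Y.PosDef) :
    Real.log (RCLike.re Y.det)
      ≤ Real.log (RCLike.re X.det) + RCLike.re (X⁻¹ * (Y - X)).trace := by
  rcases eq_or_ne Y X with rfl | hne
  · simp
  · exact (log_det_lt_tangent hX hY hne).le

lemma log_det_lt_log_det {X Y : Matrix n n 𝕜} (hX : X.PosDef) (hXY : (Y - X).PosSemidef)
    (hne : X ≠ Y) : Real.log (RCLike.re X.det) < Real.log (RCLike.re Y.det) := by
  have hY : Y.PosDef := by simpa using hX.add_posSemidef hXY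
  have htangent := log_det_lt_tangent hY hX hne
  have hnonneg := re_trace_mul_nonneg hY.inv.posSemidef hXY
  rw [← neg_sub, Matrix.mul_neg, trace_neg, map_neg] at htangent
  linarith

lemma log_det_add_log_det_lt {X Y Z : Matrix n n 𝕜} (hX : X.PosDef) (hY : Y.PosDef)
    (hmid : X + Y = Z + Z) (hne : X ≠ Y) :
    Real.log (RCLike.re X.det) + Real.log (RCLike.re Y.det)
      < 2 * Real.log (RCLike.re Z.det) := by
  have hZ : Z.PosDef := by
    have := (hX.add hY).smul (show (0 : ℝ) < 2⁻¹ by norm_num)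
    rwa [hmid, ← two_smul ℝ, smul_smul, inv_mul_cancel₀ two_ne_zero, one_smul] at this
  have hXZ : X ≠ Z := fun hXZ => hne (by simpa [hXZ, eq_comm] using hmid)
  have hcancel : RCLike.re (Z⁻¹ * (X - Z)).trace + RCLike.re (Z⁻¹ * (Y - Z)).trace = 0 := by
    rw [← map_add, ← trace_add, ← Matrix.mul_add, sub_add_sub_comm, hmid, sub_self]
    simp
  linarith [log_det_lt_tangent hZ hX hXZ, log_det_le_tangent hZ hY]

end MatrixInequalities

section RankOneUpdate

variable {R n : Type*} [CommRing R] [Fintype n] [DecidableEq n]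

lemma det_add_vecMulVec {M : Matrix n n R} (hM : IsUnit M.det) (u v : n → R) :
    (M + vecMulVec u v).det = M.det * (1 + v ⬝ᵥ M⁻¹ *ᵥ u) := by
  rw [vecMulVec_eq Unit, det_add_replicateCol_mul_replicateRow hM,
    det_unique (n := Unit), Matrix.mul_assoc, ← replicateCol_mulVec]
  simp [replicateRow_mul_replicateCol_apply]

end RankOneUpdate

section ReceivedPower

variable {ι : Type*} [Fintype ι]

lemma rxPower_add (h : ι → ℂ) (S T : Matrix ι ι ℂ) :
    rxPower h (S + T) = rxPower h S + rxPower h T := by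
  simp [rxPower, add_mulVec]

@[simp] lemma rxPower_zero_left (S : Matrix ι ι ℂ) : rxPower 0 S = 0 := by
  simp [rxPower]

lemma rxPower_sum {κ : Type*} (h : ι → ℂ) (s : Finset κ) (S : κ → Matrix ι ι ℂ) :
    rxPower h (∑ k ∈ s, S k) = ∑ k ∈ s, rxPower h (S k) := by
  simp [rxPower, sum_mulVec, dotProduct_sum]

lemma rxPower_ofReal_smul (h : ι → ℂ) (c : ℝ) (S : Matrix ι ι ℂ) :
    rxPower h ((c : ℂ) • S) = c * rxPower h S := by
  simp [rxPower, smul_mulVec]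

lemma rxPower_nonneg (h : ι → ℂ) {S : Matrix ι ι ℂ} (hS : S.PosSemidef) : 0 ≤ rxPower h S :=
  hS.re_dotProduct_nonneg h

lemma rxPower_pos {h : ι → ℂ} (hh : h ≠ 0) {S : Matrix ι ι ℂ} (hS : S.PosDef) :
    0 < rxPower h S :=
  hS.re_dotProduct_pos hh

lemma rxPower_eq_zero_iff {h : ι → ℂ} {S : Matrix ι ι ℂ} (hS : S.PosDef) :
    rxPower h S = 0 ↔ h = 0 :=
  ⟨fun h0 => by_contra fun hh => (rxPower_pos hh hS).ne' h0, fun h0 => by simp [h0]⟩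

lemma coe_rxPower (h : ι → ℂ) {S : Matrix ι ι ℂ} (hS : S.IsHermitian) :
    (rxPower h S : ℂ) = star h ⬝ᵥ S *ᵥ h :=
  Complex.ext rfl (by simpa using (hS.im_star_dotProduct_mulVec_self h).symm)

lemma star_dotProduct_mulVec {S : Matrix ι ι ℂ} (hS : S.IsHermitian) (a b : ι → ℂ) :
    star (star a ⬝ᵥ S *ᵥ b) = star b ⬝ᵥ S *ᵥ a := by
  rw [star_dotProduct, star_star, star_mulVec, hS.eq, ← dotProduct_mulVec, dotProduct_comm,
    dotProduct_comm]

lemma rxPower_vecMulVec_star_self (h w : ι → ℂ) :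
    rxPower h (vecMulVec w (star w)) = ‖star h ⬝ᵥ w‖ ^ 2 := by
  have hconj : star w ⬝ᵥ h = star (star h ⬝ᵥ w) := by
    rw [star_dotProduct]
  rw [rxPower, vecMulVec_mulVec, hconj, dotProduct_smul, op_smul_eq_mul,
    RCLike.star_def, Complex.mul_conj', ← Complex.ofReal_pow, Complex.ofReal_re]

lemma trace_vecMulVec_star_self_mul (h : ι → ℂ) (S : Matrix ι ι ℂ) :
    (vecMulVec h (star h) * S).trace = star h ⬝ᵥ S *ᵥ h := by
  rw [vecMulVec_mul, trace_vecMulVec, dotProduct_comm, dotProduct_mulVec]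

lemma re_trace_smul_vecMulVec_mul (c : ℝ) (h : ι → ℂ) (S : Matrix ι ι ℂ) :
    (((c : ℂ) • vecMulVec h (star h)) * S).trace.re = c * rxPower h S := by
  rw [Matrix.smul_mul, trace_smul, trace_vecMulVec_star_self_mul, smul_eq_mul,
    Complex.re_ofReal_mul, rxPower]

lemma posSemidef_ofReal_smul_vecMulVec {ι : Type*} [Finite ι] {c : ℝ} (hc : 0 ≤ c) (h : ι → ℂ) :
    ((c : ℂ) • vecMulVec h (star h)).PosSemidef :=
  (posSemidef_vecMulVec_self_star h).smul (by exact_mod_cast hc)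

lemma vecMulVec_ofReal_smul {ι : Type*} (c : ℝ) (w : ι → ℂ) :
    vecMulVec ((c : ℂ) • w) (star ((c : ℂ) • w)) = ((c ^ 2 : ℝ) : ℂ) • vecMulVec w (star w) := by
  rw [star_smul, vecMulVec_smul, smul_vecMulVec, smul_smul, RCLike.star_def, Complex.conj_ofReal,
    Complex.ofReal_pow, sq]

lemma eq_smul_vecMulVec_of_mul_eq {B : Matrix ι ι ℂ} (hB : B.IsHermitian) {c : ℝ}
    {h u : ι → ℂ} (hBu : B = (c : ℂ) • vecMulVec u (star h) * B) :
    B = ((c ^ 2 * rxPower h B : ℝ) : ℂ) • vecMulVec u (star u) := by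
  have hleft : B = (c : ℂ) • vecMulVec u (star (B *ᵥ h)) := by
    rwa [Matrix.smul_mul, vecMulVec_mul, ← hB.eq, ← star_mulVec, hB.eq] at hBu
  have hBh : B *ᵥ h = ((c * rxPower h B : ℝ) : ℂ) • u := by
    conv_lhs => rw [hleft]
    rw [smul_mulVec, vecMulVec_mulVec, star_mulVec, hB.eq, ← dotProduct_mulVec,
      ← coe_rxPower h hB, op_smul_eq_smul, smul_smul, Complex.ofReal_mul]
  conv_lhs => rw [hleft, hBh, star_smul, vecMulVec_smul, smul_smul]
  congr 1
  simp
  ring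

end ReceivedPower

section InverseGain

variable {ι : Type*} [Fintype ι] [DecidableEq ι] {M B : Matrix ι ι ℂ}

lemma mulVec_inv_mulVec (hM : M.PosDef) (h : ι → ℂ) : M *ᵥ M⁻¹ *ᵥ h = h := by
  rw [mulVec_mulVec, mul_nonsing_inv _ ((isUnit_iff_isUnit_det M).1 hM.isUnit), one_mulVec]

lemma posSemidef_sub_inv_rxPower_inv_smul (hM : M.PosDef) (h : ι → ℂ) :
    (M - (((rxPower h M⁻¹)⁻¹ : ℝ) : ℂ) • vecMulVec h (star h)).PosSemidef := by
  set c : ℂ := (((rxPower h M⁻¹)⁻¹ : ℝ) : ℂ) with hc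
  set u := M⁻¹ *ᵥ h with hu
  have hMu : M *ᵥ u = h := mulVec_inv_mulVec hM h
  have huM : star u ᵥ* M = star h := by
    conv_rhs => rw [← hMu, star_mulVec, hM.1.eq]
  have hhu : star h ⬝ᵥ u = c⁻¹ := by
    rw [hu, ← coe_rxPower h hM.inv.1, hc, Complex.ofReal_inv, inv_inv]
  have hcs : star c = c := Complex.conj_ofReal _
  have hker : c • (M - c • vecMulVec h (star h)) *ᵥ u = 0 := by
    rw [sub_mulVec, smul_mulVec, vecMulVec_mulVec, hMu, hhu, op_smul_eq_smul, smul_sub, smul_smul,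
      smul_smul, mul_self_mul_inv, sub_self]
  have hproj := hM.posSemidef.conjTranspose_mul_mul_same (1 - c • vecMulVec u (star h))
  rwa [conjTranspose_sub, conjTranspose_one, conjTranspose_smul, conjTranspose_vecMulVec,
    star_star, hcs, Matrix.sub_mul, Matrix.one_mul, Matrix.smul_mul, vecMulVec_mul, huM,
    Matrix.mul_sub, Matrix.mul_one, Matrix.mul_smul, mul_vecMulVec,
    ← smul_vecMulVec c (_ *ᵥ u), hker, zero_vecMulVec, sub_zero] at hproj

lemma rxPower_div_le_re_trace_mul (hM : M.PosDef) (hB : B.PosSemidef) (h : ι → ℂ) :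
    rxPower h B / rxPower h M⁻¹ ≤ (M * B).trace.re := by
  have hnonneg := re_trace_mul_nonneg (posSemidef_sub_inv_rxPower_inv_smul hM h) hB
  rw [Matrix.sub_mul, trace_sub, map_sub, RCLike.re_eq_complex_re, re_trace_smul_vecMulVec_mul,
    sub_nonneg] at hnonneg
  rwa [div_eq_inv_mul]

lemma eq_smul_vecMulVec_of_rxPower_div_eq (hM : M.PosDef) (hB : B.PosSemidef) {h : ι → ℂ}
    (heq : rxPower h B / rxPower h M⁻¹ = (M * B).trace.re) :
    B = ((rxPower h B / rxPower h M⁻¹ ^ 2 : ℝ) : ℂ) •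
      vecMulVec (M⁻¹ *ᵥ h) (star (M⁻¹ *ᵥ h)) := by
  have hMB : M * B = (((rxPower h M⁻¹)⁻¹ : ℝ) : ℂ) • vecMulVec h (star h) * B := by
    rw [← sub_eq_zero, ← Matrix.sub_mul]
    refine mul_eq_zero_of_re_trace_mul_eq_zero (posSemidef_sub_inv_rxPower_inv_smul hM h) hB ?_
    rw [Matrix.sub_mul, trace_sub, map_sub, RCLike.re_eq_complex_re, re_trace_smul_vecMulVec_mul,
      ← heq, div_eq_inv_mul, sub_self]
  have hB' : B = (((rxPower h M⁻¹)⁻¹ : ℝ) : ℂ) • vecMulVec (M⁻¹ *ᵥ h) (star h) * B := by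
    have hdet := (isUnit_iff_isUnit_det M).1 hM.isUnit
    conv_lhs => rw [← nonsing_inv_mul_cancel_left M B hdet, hMB]
    rw [← Matrix.mul_assoc, Matrix.mul_smul, mul_vecMulVec]
  rw [div_eq_inv_mul, ← inv_pow]
  exact eq_smul_vecMulVec_of_mul_eq hB.1 hB'

lemma rxPower_inv_sub_rxPower_inv {N : Matrix ι ι ℂ} (hM : M.PosDef) (hN : N.PosDef)
    (g : ι → ℂ) :
    rxPower g M⁻¹ - rxPower g N⁻¹
      = rxPower (M⁻¹ *ᵥ g - N⁻¹ *ᵥ g) M + rxPower (N⁻¹ *ᵥ g) (N - M) := by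
  have hx : M *ᵥ M⁻¹ *ᵥ g = g := mulVec_inv_mulVec hM g
  have hy : N *ᵥ N⁻¹ *ᵥ g = g := mulVec_inv_mulVec hN g
  set x := M⁻¹ *ᵥ g
  set y := N⁻¹ *ᵥ g
  have hre (z : ι → ℂ) : (star g ⬝ᵥ z).re = (star z ⬝ᵥ g).re := by
    rw [star_dotProduct]
    exact Complex.conj_re _
  have hxy : (star x ⬝ᵥ M *ᵥ y).re = (star y ⬝ᵥ g).re := by
    rw [← star_dotProduct_mulVec hM.1, hx]
    exact Complex.conj_re _
  simp only [rxPower, mulVec_sub, sub_mulVec, star_sub, sub_dotProduct, dotProduct_sub,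
    Complex.sub_re, hx, hy, hxy]
  rw [show M⁻¹ *ᵥ g = x from rfl, show N⁻¹ *ᵥ g = y from rfl, hre x, hre y]
  ring

lemma re_det_add_smul_vecMulVec (hM : M.PosDef) (c : ℝ) (h : ι → ℂ) :
    (M + (c : ℂ) • vecMulVec h (star h)).det.re = M.det.re * (1 + c * rxPower h M⁻¹) := by
  rw [← smul_vecMulVec, det_add_vecMulVec ((isUnit_iff_isUnit_det M).1 hM.isUnit), mulVec_smul,
    dotProduct_smul, ← coe_rxPower h hM.inv.1, smul_eq_mul, ← Complex.ofReal_mul,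
    ← Complex.ofReal_one, ← Complex.ofReal_add, Complex.re_mul_ofReal]

lemma norm_sq_star_dotProduct_eq_mul_rxPower (hM : M.PosDef) (h : ι → ℂ)
    (t : ℝ) :
    ‖star h ⬝ᵥ ((t : ℂ) • M⁻¹ *ᵥ h)‖ ^ 2
      = rxPower h M⁻¹ * rxPower ((t : ℂ) • M⁻¹ *ᵥ h) M := by
  have hgain := coe_rxPower h hM.inv.1
  have hrx : rxPower ((t : ℂ) • M⁻¹ *ᵥ h) M = t ^ 2 * rxPower h M⁻¹ := by
    rw [rxPower, mulVec_smul, mulVec_inv_mulVec hM, dotProduct_smul, star_smul, smul_dotProduct,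
      star_dotProduct, ← hgain]
    simp [sq, mul_assoc]
  rw [hrx, dotProduct_smul, ← hgain, smul_eq_mul, ← Complex.ofReal_mul, Complex.norm_real,
    Real.norm_eq_abs, sq_abs]
  ring

end InverseGain

lemma exists_forall_eq_of_wellFounded {κ β : Type*} [Nonempty β] {r : κ → κ → Prop}
    (wf : WellFounded r) (F : κ → (κ → β) → β)
    (hF : ∀ i g g', (∀ k, r k i → g k = g' k) → F i g = F i g') : ∃ g, ∀ i, g i = F i g := by
  classical
  refine ⟨wf.fix fun i rec => F i fun k => if hk : r k i then rec k hk else Classical.ofNonempty,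
    fun i => ?_⟩
  rw [wf.fix_eq]
  exact hF _ _ _ fun k hk => by simp [hk]

section Channels

variable {ι : Type*} {K : ℕ}

lemma macCov_congr (A : Matrix ι ι ℂ) (h : Fin K → ι → ℂ) {π : Equiv.Perm (Fin K)}
    {p p' : Fin K → ℝ} {s : Finset (Fin K)} (hpp : ∀ k ∈ s, p (π k) = p' (π k)) :
    macCov A h π p s = macCov A h π p' s := by
  rw [macCov, macCov, Finset.sum_congr rfl fun k hk => by rw [hpp k hk]]

lemma macCov_insert (A : Matrix ι ι ℂ) (h : Fin K → ι → ℂ) (π : Equiv.Perm (Fin K))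
    (p : Fin K → ℝ) {s : Finset (Fin K)} {i : Fin K} (hi : i ∉ s) :
    macCov A h π p (insert i s)
      = macCov A h π p s + (p (π i) : ℂ) • vecMulVec (h (π i)) (star (h (π i))) := by
  rw [macCov, macCov, Finset.sum_insert hi, add_comm (_ • _), add_assoc]

lemma macCov_Iic (A : Matrix ι ι ℂ) (h : Fin K → ι → ℂ) (π : Equiv.Perm (Fin K))
    (p : Fin K → ℝ) (i : Fin K) :
    macCov A h π p (Finset.Iic i)
      = macCov A h π p (Finset.Iio i) + (p (π i) : ℂ) • vecMulVec (h (π i)) (star (h (π i))) := by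
  rw [← Finset.Iio_insert, macCov_insert A h π p (by simp)]

lemma posDef_macCov [Finite ι] {A : Matrix ι ι ℂ} (hA : A.PosDef) (h : Fin K → ι → ℂ)
    (π : Equiv.Perm (Fin K)) {p : Fin K → ℝ} (hp : ∀ i, 0 ≤ p i) (s : Finset (Fin K)) :
    (macCov A h π p s).PosDef :=
  hA.add_posSemidef (posSemidef_sum _ fun k _ => posSemidef_ofReal_smul_vecMulVec (hp (π k)) _)

variable [Fintype ι]

lemma re_trace_macCov_mul (A : Matrix ι ι ℂ) (h : Fin K → ι → ℂ) (π : Equiv.Perm (Fin K))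
    (p : Fin K → ℝ) (s : Finset (Fin K)) (S : Matrix ι ι ℂ) :
    (macCov A h π p s * S).trace.re
      = (A * S).trace.re + ∑ k ∈ s, p (π k) * rxPower (h (π k)) S := by
  simp only [macCov, Matrix.add_mul, trace_add, Complex.add_re, Matrix.sum_mul, trace_sum,
    Complex.re_sum, re_trace_smul_vecMulVec_mul]

/-- The noise plus interference of user `π i` in the broadcast channel, the denominator of its
dirty-paper-coding rate. -/
def bcNoise (nv : ℝ) (h : Fin K → ι → ℂ) (S : Fin K → Matrix ι ι ℂ) (π : Equiv.Perm (Fin K))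
    (i : Fin K) : ℝ :=
  nv + rxPower (h (π i)) (∑ k ∈ Finset.Ioi i, S (π k))

lemma bcNoise_eq_add_sum (nv : ℝ) (h : Fin K → ι → ℂ) (S : Fin K → Matrix ι ι ℂ)
    (π : Equiv.Perm (Fin K)) (i : Fin K) :
    bcNoise nv h S π i = nv + ∑ k ∈ Finset.Ioi i, rxPower (h (π i)) (S (π k)) := by
  rw [bcNoise, rxPower_sum]

lemma bcNoise_pos {nv : ℝ} (hnv : 0 < nv) (h : Fin K → ι → ℂ) {S : Fin K → Matrix ι ι ℂ}
    (hS : ∀ i, (S i).PosSemidef) (π : Equiv.Perm (Fin K)) (i : Fin K) :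
    0 < bcNoise nv h S π i :=
  add_pos_of_pos_of_nonneg hnv (rxPower_nonneg _ (posSemidef_sum _ fun _ _ => hS _))

lemma dpcRate_eq_logb {nv : ℝ} (hnv : 0 < nv) (h : Fin K → ι → ℂ) {S : Fin K → Matrix ι ι ℂ}
    (hS : ∀ i, (S i).PosSemidef) (π : Equiv.Perm (Fin K)) (i : Fin K) :
    dpcRate nv h S π i = Real.logb 2 (1 + rxPower (h (π i)) (S (π i)) / bcNoise nv h S π i) := by
  have hnoise := (bcNoise_pos hnv h hS π i).ne'
  rw [one_add_div hnoise, dpcRate, ← Finset.Ioi_insert, Finset.sum_insert (by simp), rxPower_add,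
    bcNoise]
  congr 2
  ring

/-- Exchanging the order of summation turns the interference caused by user `π i` in the broadcast
channel into the interference it suffers in the dual multiple access channel. -/
lemma sum_re_trace_macCov_mul_sub (nv : ℝ) (A : Matrix ι ι ℂ) (h : Fin K → ι → ℂ)
    (S : Fin K → Matrix ι ι ℂ) (π : Equiv.Perm (Fin K)) (p : Fin K → ℝ) :
    ∑ i, (macCov A h π p (Finset.Iio i) * S (π i)).trace.re - ∑ i, p (π i) * bcNoise nv h S π i
      = (∑ i, (A * S i).trace).re - nv * ∑ i, p i := by
  have hcomm : ∑ i, ∑ k ∈ Finset.Iio i, p (π k) * rxPower (h (π k)) (S (π i))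
      = ∑ i, ∑ k ∈ Finset.Ioi i, p (π i) * rxPower (h (π i)) (S (π k)) :=
    Finset.sum_comm' (by simp)
  simp only [re_trace_macCov_mul, bcNoise_eq_add_sum, mul_add, Finset.mul_sum,
    Finset.sum_add_distrib, Complex.re_sum, hcomm]
  rw [Equiv.sum_comp π fun i => (A * S i).trace.re, Equiv.sum_comp π fun i => p i * nv]
  simp only [mul_comm nv, add_sub_add_right_eq_sub]

variable [DecidableEq ι]

/-- The gain `hᴴ M⁻¹ h` of user `π i` in the dual multiple access channel, where `M` is the noise
plus interference it suffers there. -/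
noncomputable def macGain (A : Matrix ι ι ℂ) (h : Fin K → ι → ℂ) (π : Equiv.Perm (Fin K))
    (p : Fin K → ℝ) (i : Fin K) : ℝ :=
  rxPower (h (π i)) (macCov A h π p (Finset.Iio i))⁻¹

variable {nv : ℝ} {A : Matrix ι ι ℂ} {h : Fin K → ι → ℂ} {S : Fin K → Matrix ι ι ℂ}
  {π : Equiv.Perm (Fin K)} {p q : Fin K → ℝ}

lemma macGain_nonneg (hA : A.PosDef) (hp : ∀ i, 0 ≤ p i) (i : Fin K) : 0 ≤ macGain A h π p i :=
  rxPower_nonneg _ (posDef_macCov hA h π hp _).inv.posSemidef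

lemma macGain_eq_zero_iff (hA : A.PosDef) (hp : ∀ i, 0 ≤ p i) {i : Fin K} :
    macGain A h π p i = 0 ↔ h (π i) = 0 :=
  rxPower_eq_zero_iff (posDef_macCov hA h π hp _).inv

lemma macRateAt_eq_logb (hA : A.PosDef) (hp : ∀ i, 0 ≤ p i) (i : Fin K) :
    macRateAt A h π p i = Real.logb 2 (1 + p (π i) * macGain A h π p i) := by
  have hM := posDef_macCov hA h π hp (Finset.Iio i)
  have hdet : (macCov A h π p (Finset.Iio i)).det.re ≠ 0 := (re_det_pos hM).ne'
  rw [macRateAt, macCov_Iic, re_det_add_smul_vecMulVec hM, macGain, mul_div_cancel_left₀ _ hdet]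

lemma mul_macGain_nonneg (hA : A.PosDef) (hp : ∀ i, 0 ≤ p i) (i : Fin K) :
    0 ≤ p (π i) * macGain A h π p i :=
  mul_nonneg (hp _) (macGain_nonneg hA hp i)

lemma macRateAt_nonneg (hA : A.PosDef) (hp : ∀ i, 0 ≤ p i) (i : Fin K) :
    0 ≤ macRateAt A h π p i := by
  rw [macRateAt_eq_logb hA hp]
  exact Real.logb_nonneg one_lt_two (le_add_of_nonneg_right (mul_macGain_nonneg hA hp i))

lemma two_rpow_macRateAt_sub_one (hA : A.PosDef) (hp : ∀ i, 0 ≤ p i) (i : Fin K) :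
    (2 : ℝ) ^ macRateAt A h π p i - 1 = p (π i) * macGain A h π p i := by
  rw [macRateAt_eq_logb hA hp, Real.rpow_logb two_pos (by norm_num)
    (add_pos_of_pos_of_nonneg one_pos (mul_macGain_nonneg hA hp i)), add_sub_cancel_left]

/-! ### From the broadcast channel to the dual multiple access channel -/

/-- `p` solves the triangular system of uplink powers: every user obtains in the dual multiple
access channel the rate it has in the broadcast channel with the covariances `S`. -/
def IsUplinkPower (nv : ℝ) (A : Matrix ι ι ℂ) (h : Fin K → ι → ℂ) (S : Fin K → Matrix ι ι ℂ)
    (π : Equiv.Perm (Fin K)) (p : Fin K → ℝ) : Prop :=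
  ∀ i, p (π i) = rxPower (h (π i)) (S (π i)) / (bcNoise nv h S π i * macGain A h π p i)

/-- The covariances `S` are multiples of `u uᴴ` for the unnormalized MMSE receivers
`u = M⁻¹ h` of the dual multiple access channel, with the factors that `IsUplinkPower` dictates. -/
def IsMmseCovariance (nv : ℝ) (A : Matrix ι ι ℂ) (h : Fin K → ι → ℂ)
    (S : Fin K → Matrix ι ι ℂ) (π : Equiv.Perm (Fin K)) (p : Fin K → ℝ) : Prop :=
  ∀ i, S (π i) = ((p (π i) * bcNoise nv h S π i / macGain A h π p i : ℝ) : ℂ) •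
    vecMulVec ((macCov A h π p (Finset.Iio i))⁻¹ *ᵥ h (π i))
      (star ((macCov A h π p (Finset.Iio i))⁻¹ *ᵥ h (π i)))

lemma exists_isUplinkPower (hnv : 0 < nv) (hA : A.PosDef) (h : Fin K → ι → ℂ)
    (hS : ∀ i, (S i).PosSemidef) (π : Equiv.Perm (Fin K)) :
    ∃ p : Fin K → ℝ, (∀ i, 0 ≤ p i) ∧ IsUplinkPower nv A h S π p := by
  obtain ⟨g, hg⟩ := exists_forall_eq_of_wellFounded (β := NNReal)
    (InvImage.wf π.symm wellFounded_lt)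
    (fun j g => (rxPower (h j) (S j) / (bcNoise nv h S π (π.symm j) *
      macGain A h π (fun k => g k) (π.symm j))).toNNReal) fun j g g' hgg => by
        have hcov : macCov A h π (fun k => g k) (Finset.Iio (π.symm j))
            = macCov A h π (fun k => g' k) (Finset.Iio (π.symm j)) :=
          macCov_congr A h fun k hk => by
            rw [hgg (π k) (by simpa [InvImage] using Finset.mem_Iio.1 hk)]
        rw [macGain, macGain, hcov]
  refine ⟨fun j => g j, fun j => (g j).2, fun i => ?_⟩
  have hgain := macGain_nonneg (h := h) (π := π) hA (fun j => (g j).2) i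
  beta_reduce
  rw [hg (π i), Equiv.symm_apply_apply, Real.coe_toNNReal]
  exact div_nonneg (rxPower_nonneg _ (hS _)) (mul_nonneg (bcNoise_pos hnv h hS π i).le hgain)

namespace IsUplinkPower

lemma mul_bcNoise (hup : IsUplinkPower nv A h S π p) (hnv : 0 < nv) (hS : ∀ i, (S i).PosSemidef)
    (i : Fin K) :
    p (π i) * bcNoise nv h S π i = rxPower (h (π i)) (S (π i)) / macGain A h π p i := by
  rw [hup, div_mul_eq_mul_div, mul_comm _ (bcNoise nv h S π i),
    mul_div_mul_left _ _ (bcNoise_pos hnv h hS π i).ne']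

lemma macRateAt_eq (hup : IsUplinkPower nv A h S π p) (hnv : 0 < nv) (hA : A.PosDef)
    (hS : ∀ i, (S i).PosSemidef) (hp : ∀ i, 0 ≤ p i) (i : Fin K) :
    macRateAt A h π p i = dpcRate nv h S π i := by
  rw [macRateAt_eq_logb hA hp, dpcRate_eq_logb hnv h hS]
  congr 2
  rw [eq_div_iff (bcNoise_pos hnv h hS π i).ne', mul_right_comm, hup.mul_bcNoise hnv hS]
  exact div_mul_cancel_of_imp fun h0 => by simp [(macGain_eq_zero_iff hA hp).1 h0]

lemma mul_bcNoise_le (hup : IsUplinkPower nv A h S π p) (hnv : 0 < nv) (hA : A.PosDef)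
    (hS : ∀ i, (S i).PosSemidef) (hp : ∀ i, 0 ≤ p i) (i : Fin K) :
    p (π i) * bcNoise nv h S π i ≤ (macCov A h π p (Finset.Iio i) * S (π i)).trace.re := by
  rw [hup.mul_bcNoise hnv hS]
  exact rxPower_div_le_re_trace_mul (posDef_macCov hA h π hp _) (hS _) _

lemma mul_sum_le (hup : IsUplinkPower nv A h S π p) (hnv : 0 < nv) (hA : A.PosDef)
    (hS : ∀ i, (S i).PosSemidef) (hp : ∀ i, 0 ≤ p i) :
    nv * ∑ i, p i ≤ (∑ i, (A * S i).trace).re := by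
  have hle := Finset.sum_le_sum fun i (_ : i ∈ Finset.univ) => hup.mul_bcNoise_le hnv hA hS hp i
  linarith [sum_re_trace_macCov_mul_sub nv A h S π p]

lemma isMmseCovariance (hup : IsUplinkPower nv A h S π p) (hnv : 0 < nv) (hA : A.PosDef)
    (hS : ∀ i, (S i).PosSemidef) (hp : ∀ i, 0 ≤ p i)
    (heq : nv * ∑ i, p i = (∑ i, (A * S i).trace).re) : IsMmseCovariance nv A h S π p := by
  intro i
  have htrace := (Finset.sum_eq_sum_iff_of_le fun i (_ : i ∈ Finset.univ) =>
    hup.mul_bcNoise_le hnv hA hS hp i).1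
    (by linarith [sum_re_trace_macCov_mul_sub nv A h S π p]) i (Finset.mem_univ i)
  rw [hup.mul_bcNoise hnv hS] at htrace ⊢
  rw [div_div, ← sq]
  exact eq_smul_vecMulVec_of_rxPower_div_eq (posDef_macCov hA h π hp _) (hS _) htrace

end IsUplinkPower

/-! ### From the dual multiple access channel to the broadcast channel -/

lemma mmseBeam_apply (A : Matrix ι ι ℂ) (h : Fin K → ι → ℂ) (π : Equiv.Perm (Fin K))
    (p : Fin K → ℝ) (i : Fin K) : ∃ t : ℝ, mmseBeam A h π p (π i)
      = (t : ℂ) • (macCov A h π p (Finset.Iio i))⁻¹ *ᵥ h (π i) :=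
  ⟨_, by rw [mmseBeam, Equiv.symm_apply_apply]⟩

lemma norm_sq_star_dotProduct_mmseBeam (hA : A.PosDef) (hp : ∀ i, 0 ≤ p i) (i : Fin K) :
    ‖star (h (π i)) ⬝ᵥ mmseBeam A h π p (π i)‖ ^ 2 = macGain A h π p i *
      rxPower (mmseBeam A h π p (π i)) (macCov A h π p (Finset.Iio i)) := by
  obtain ⟨t, ht⟩ := mmseBeam_apply A h π p i
  rw [ht, macGain]
  exact norm_sq_star_dotProduct_eq_mul_rxPower (posDef_macCov hA h π hp _) _ t

lemma mmseBeam_eq_zero_iff (hA : A.PosDef) (hp : ∀ i, 0 ≤ p i) {i : Fin K} :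
    mmseBeam A h π p (π i) = 0 ↔ h (π i) = 0 := by
  have hM := posDef_macCov hA h π hp (Finset.Iio i)
  rw [mmseBeam, Equiv.symm_apply_apply, smul_eq_zero, Complex.ofReal_eq_zero, inv_eq_zero,
    norm_eq_zero, WithLp.toLp_eq_zero, or_self]
  refine ⟨fun h0 => ?_, fun h0 => by rw [h0, mulVec_zero]⟩
  rw [← mulVec_inv_mulVec hM (h (π i)), h0, mulVec_zero]

lemma posSemidef_beamCov (A : Matrix ι ι ℂ) (h : Fin K → ι → ℂ) (π : Equiv.Perm (Fin K))
    (p q : Fin K → ℝ) (j : Fin K) : (beamCov A h π p q j).PosSemidef :=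
  posSemidef_vecMulVec_self_star _

lemma beamCov_eq_smul (hq : ∀ i, 0 ≤ q i) (j : Fin K) :
    beamCov A h π p q j
      = (q j : ℂ) • vecMulVec (mmseBeam A h π p j) (star (mmseBeam A h π p j)) := by
  rw [beamCov, vecMulVec_ofReal_smul, Real.sq_sqrt (hq j)]

lemma rxPower_beamCov (hq : ∀ i, 0 ≤ q i) (j : Fin K) (g : ι → ℂ) :
    rxPower g (beamCov A h π p q j) = q j * ‖star g ⬝ᵥ mmseBeam A h π p j‖ ^ 2 := by
  rw [beamCov_eq_smul hq, rxPower_ofReal_smul, rxPower_vecMulVec_star_self]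

lemma exists_isDownlinkPower (hnv : 0 ≤ nv) (hA : A.PosDef) (h : Fin K → ι → ℂ)
    (π : Equiv.Perm (Fin K)) (hp : ∀ i, 0 ≤ p i) :
    ∃ q : Fin K → ℝ, (∀ i, 0 ≤ q i) ∧ IsDownlinkPower nv A h π p q := by
  obtain ⟨g, hg⟩ := exists_forall_eq_of_wellFounded (β := NNReal)
    (InvImage.wf π.symm wellFounded_gt)
    (fun j g => (((2 : ℝ) ^ macRateAt A h π p (π.symm j) - 1) /
      ‖star (h j) ⬝ᵥ mmseBeam A h π p j‖ ^ 2 * (∑ k ∈ Finset.Ioi (π.symm j),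
        g (π k) * ‖star (h j) ⬝ᵥ mmseBeam A h π p (π k)‖ ^ 2 + nv)).toNNReal)
    fun j g g' hgg => by
      have hinterf : ∀ k ∈ Finset.Ioi (π.symm j), g (π k) = g' (π k) := fun k hk =>
        hgg (π k) (by simpa [InvImage] using Finset.mem_Ioi.1 hk)
      rw [Finset.sum_congr rfl fun k hk => by rw [hinterf k hk]]
  refine ⟨fun j => g j, fun j => (g j).2, fun i => ?_⟩
  beta_reduce
  rw [hg (π i), Equiv.symm_apply_apply]
  refine Real.coe_toNNReal _ ?_
  rw [two_rpow_macRateAt_sub_one hA hp]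
  have := mul_macGain_nonneg (h := h) (π := π) hA hp i
  positivity

namespace IsDownlinkPower

lemma rxPower_beamCov_self (hdown : IsDownlinkPower nv A h π p q) (hA : A.PosDef)
    (hp : ∀ i, 0 ≤ p i) (hq : ∀ i, 0 ≤ q i) (i : Fin K) :
    rxPower (h (π i)) (beamCov A h π p q (π i))
      = p (π i) * macGain A h π p i * bcNoise nv h (beamCov A h π p q) π i := by
  have hnoise : bcNoise nv h (beamCov A h π p q) π i
      = ∑ k ∈ Finset.Ioi i, q (π k) * ‖star (h (π i)) ⬝ᵥ mmseBeam A h π p (π k)‖ ^ 2 + nv := by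
    simp only [bcNoise_eq_add_sum, rxPower_beamCov hq, add_comm]
  rw [rxPower_beamCov hq, hdown i, two_rpow_macRateAt_sub_one hA hp, ← hnoise, mul_right_comm]
  congr 1
  refine div_mul_cancel_of_imp fun h0 => ?_
  rw [norm_sq_star_dotProduct_mmseBeam hA hp, mul_eq_zero,
    rxPower_eq_zero_iff (posDef_macCov hA h π hp _), mmseBeam_eq_zero_iff hA hp,
    macGain_eq_zero_iff hA hp, or_self] at h0
  rw [(macGain_eq_zero_iff hA hp).2 h0, mul_zero]

lemma dpcRate_beamCov (hdown : IsDownlinkPower nv A h π p q) (hnv : 0 < nv) (hA : A.PosDef)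
    (hp : ∀ i, 0 ≤ p i) (hq : ∀ i, 0 ≤ q i) (i : Fin K) :
    dpcRate nv h (beamCov A h π p q) π i = macRateAt A h π p i := by
  have hB := posSemidef_beamCov A h π p q
  rw [macRateAt_eq_logb hA hp, dpcRate_eq_logb hnv h hB, hdown.rxPower_beamCov_self hA hp hq,
    mul_div_cancel_right₀ _ (bcNoise_pos hnv h hB π i).ne']

lemma re_trace_macCov_mul_beamCov_le (hdown : IsDownlinkPower nv A h π p q) (hnv : 0 < nv)
    (hA : A.PosDef) (hp : ∀ i, 0 ≤ p i) (hq : ∀ i, 0 ≤ q i) (i : Fin K) :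
    (macCov A h π p (Finset.Iio i) * beamCov A h π p q (π i)).trace.re
      ≤ p (π i) * bcNoise nv h (beamCov A h π p q) π i := by
  have htrace : (macCov A h π p (Finset.Iio i) * beamCov A h π p q (π i)).trace.re
      = q (π i) * rxPower (mmseBeam A h π p (π i)) (macCov A h π p (Finset.Iio i)) := by
    rw [trace_mul_comm, beamCov_eq_smul hq, re_trace_smul_vecMulVec_mul]
  rw [htrace]
  rcases eq_or_ne (macGain A h π p i) 0 with h0 | h0
  · rw [(mmseBeam_eq_zero_iff hA hp).2 ((macGain_eq_zero_iff hA hp).1 h0), rxPower_zero_left,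
      mul_zero]
    exact mul_nonneg (hp _) (bcNoise_pos hnv h (posSemidef_beamCov A h π p q) π i).le
  · refine (mul_left_cancel₀ h0 ?_).le
    rw [mul_left_comm, ← norm_sq_star_dotProduct_mmseBeam hA hp, ← rxPower_beamCov hq,
      hdown.rxPower_beamCov_self hA hp hq]
    ring

lemma re_sum_trace_le (hdown : IsDownlinkPower nv A h π p q) (hnv : 0 < nv) (hA : A.PosDef)
    (hp : ∀ i, 0 ≤ p i) (hq : ∀ i, 0 ≤ q i) :
    (∑ i, (A * beamCov A h π p q i).trace).re ≤ nv * ∑ i, p i := by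
  have hle := Finset.sum_le_sum fun i (_ : i ∈ Finset.univ) =>
    hdown.re_trace_macCov_mul_beamCov_le hnv hA hp hq i
  linarith [sum_re_trace_macCov_mul_sub nv A h (beamCov A h π p q) π p]

end IsDownlinkPower

end Channels

/-! ### Submodularity of the sum rate and decoding orders -/

section Polymatroid

lemma exists_abel_weights {n : ℕ} {a : Fin n → ℝ} (ha : Antitone a) (ha0 : ∀ i, 0 ≤ a i) :
    ∃ w : Fin n → ℝ, (∀ i, 0 ≤ w i) ∧ (∀ i, 0 < a i → (∀ j, i < j → a j < a i) → 0 < w i) ∧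
      ∀ x : Fin n → ℝ, ∑ i, a i * x i = ∑ i, w i * ∑ j ∈ Finset.Iic i, x j := by
  induction n with
  | zero => exact ⟨a, fun i => i.elim0, fun i => i.elim0, fun x => by simp⟩
  | succ n ih =>
    have hlast (i : Fin n) : a (Fin.last n) ≤ a i.castSucc := ha (Fin.le_last _)
    obtain ⟨w, hw0, hwpos, hw⟩ := ih (a := fun i => a i.castSucc - a (Fin.last n))
      (fun i j hij => sub_le_sub_right (ha (Fin.castSucc_le_castSucc_iff.2 hij)) _)
      (fun i => sub_nonneg.2 (hlast i))
    refine ⟨Fin.snoc w (a (Fin.last n)), fun i => ?_, fun i hi hdrop => ?_, fun x => ?_⟩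
    · cases i using Fin.lastCases with
      | last => simpa using ha0 _
      | cast i => simpa using hw0 i
    · cases i using Fin.lastCases with
      | last => simpa using hi
      | cast i =>
        simpa using hwpos i (sub_pos.2 (hdrop _ (Fin.castSucc_lt_last i)))
          fun j hij => sub_lt_sub_right (hdrop _ (Fin.castSucc_lt_castSucc_iff.2 hij)) _
    · have hx := hw fun i => x i.castSucc
      simp only [sub_mul, Finset.sum_sub_distrib, ← Finset.mul_sum] at hx
      have hIic (i : Fin n) : ∑ j ∈ Finset.Iic i.castSucc, x j
          = ∑ j ∈ Finset.Iic i, x j.castSucc := by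
        rw [← Fin.map_castSuccEmb_Iic, Finset.sum_map]
        rfl
      have htop : (Finset.Iic (Fin.last n)) = Finset.univ := Finset.Iic_top
      simp only [Fin.sum_univ_castSucc, Fin.snoc_castSucc, Fin.snoc_last, hIic, ← hx, htop]
      ring

variable {ι : Type*} {K : ℕ}

/-- The users that the order `π` places before the user `u`. -/
def earlier (π : Equiv.Perm (Fin K)) (u : Fin K) : Finset (Fin K) :=
  {v | π.symm v < π.symm u}

@[simp] lemma mem_earlier {π : Equiv.Perm (Fin K)} {u v : Fin K} :
    v ∈ earlier π u ↔ π.symm v < π.symm u := by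
  simp [earlier]

lemma sum_Iio_symm (π : Equiv.Perm (Fin K)) (u : Fin K) {E : Type*} [AddCommMonoid E]
    (f : Fin K → E) : ∑ i ∈ Finset.Iio (π.symm u), f (π i) = ∑ v ∈ earlier π u, f v :=
  Finset.sum_equiv π (by simp) fun _ _ => rfl

lemma sum_Iic_symm (π : Equiv.Perm (Fin K)) (u : Fin K) {E : Type*} [AddCommMonoid E]
    (f : Fin K → E) :
    ∑ i ∈ Finset.Iic (π.symm u), f (π i) = ∑ v ∈ insert u (earlier π u), f v := by
  rw [← Finset.Iio_insert, Finset.sum_insert (by simp), Finset.sum_insert (by simp),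
    sum_Iio_symm, Equiv.apply_symm_apply]

lemma macCov_one_earlier (A : Matrix ι ι ℂ) (h : Fin K → ι → ℂ) (π : Equiv.Perm (Fin K))
    (p : Fin K → ℝ) (u : Fin K) :
    macCov A h 1 p (earlier π u) = macCov A h π p (Finset.Iio (π.symm u)) := by
  rw [macCov, macCov, sum_Iio_symm π u fun v => (p v : ℂ) • vecMulVec (h v) (star (h v))]
  rfl

lemma macCov_one_sub (A : Matrix ι ι ℂ) (h : Fin K → ι → ℂ) (p : Fin K → ℝ)
    {T T' : Finset (Fin K)} (hT : T ⊆ T') :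
    macCov A h 1 p T' - macCov A h 1 p T
      = ∑ v ∈ T' \ T, (p v : ℂ) • vecMulVec (h v) (star (h v)) := by
  rw [macCov, macCov, add_sub_add_left_eq_sub, ← Finset.sum_sdiff hT, add_sub_cancel_right]
  rfl

lemma rxPower_macCov_one_sub [Fintype ι] (A : Matrix ι ι ℂ) (h : Fin K → ι → ℂ) (p : Fin K → ℝ)
    {T T' : Finset (Fin K)} (hT : T ⊆ T') (y : ι → ℂ) :
    rxPower y (macCov A h 1 p T' - macCov A h 1 p T)
      = ∑ v ∈ T' \ T, p v * ‖star y ⬝ᵥ h v‖ ^ 2 := by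
  simp only [macCov_one_sub A h p hT, rxPower_sum, rxPower_ofReal_smul,
    rxPower_vecMulVec_star_self]

section LevelSets

variable {α x y : Fin K → ℝ} {π : Equiv.Perm (Fin K)}

lemma exists_eq_insert_earlier (hπ : Antitone (α ∘ π)) {T : Finset (Fin K)} (hne : T.Nonempty)
    (hT : ∀ u ∈ T, ∀ v ∉ T, α v < α u) : ∃ u, T = insert u (earlier π u) := by
  obtain ⟨u, huT, hmax⟩ := Finset.exists_max_image T π.symm hne
  refine ⟨u, Finset.ext fun v => ?_⟩
  rw [Finset.mem_insert, mem_earlier, ← π.symm.injective.eq_iff, ← le_iff_eq_or_lt]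
  refine ⟨hmax v, fun hvu => by_contra fun hv => (hT u huT v hv).not_ge ?_⟩
  simpa using hπ hvu

lemma sum_mul_le_sum_mul (hα : ∀ i, 0 ≤ α i) (hπ : Antitone (α ∘ π))
    (hxy : ∀ u, ∑ v ∈ insert u (earlier π u), x v ≤ ∑ v ∈ insert u (earlier π u), y v) :
    ∑ u, α u * x u ≤ ∑ u, α u * y u := by
  obtain ⟨w, hw0, -, hw⟩ := exists_abel_weights hπ fun i => hα (π i)
  rw [← Equiv.sum_comp π, ← Equiv.sum_comp π fun u => α u * y u]
  refine (hw fun i => x (π i)).trans_le <| le_of_le_of_eq ?_ (hw fun i => y (π i)).symm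
  refine Finset.sum_le_sum fun i _ => mul_le_mul_of_nonneg_left ?_ (hw0 i)
  simpa only [← sum_Iic_symm, Equiv.symm_apply_apply] using hxy (π i)

lemma sum_eq_sum_of_sum_mul_eq (hα : ∀ i, 0 < α i) (hπ : Antitone (α ∘ π))
    (hxy : ∀ u, ∑ v ∈ insert u (earlier π u), x v ≤ ∑ v ∈ insert u (earlier π u), y v)
    (heq : ∑ u, α u * x u = ∑ u, α u * y u) {T : Finset (Fin K)}
    (hT : ∀ u ∈ T, ∀ v ∉ T, α v < α u) : ∑ u ∈ T, x u = ∑ u ∈ T, y u := by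
  rcases T.eq_empty_or_nonempty with rfl | hne
  · simp
  obtain ⟨u, hu⟩ := exists_eq_insert_earlier hπ hne hT
  obtain ⟨w, hw0, hwpos, hw⟩ := exists_abel_weights hπ fun i => (hα (π i)).le
  have hsums (i : Fin K) : w i * ∑ j ∈ Finset.Iic i, x (π j) ≤ w i * ∑ j ∈ Finset.Iic i, y (π j) :=
    mul_le_mul_of_nonneg_left (by
      simpa only [← sum_Iic_symm, Equiv.symm_apply_apply] using hxy (π i)) (hw0 i)
  rw [← Equiv.sum_comp π, ← Equiv.sum_comp π fun u => α u * y u] at heq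
  have hterm := (Finset.sum_eq_sum_iff_of_le fun i (_ : i ∈ Finset.univ) => hsums i).1
    (((hw fun i => x (π i)).symm.trans heq).trans (hw fun i => y (π i))) (π.symm u)
    (Finset.mem_univ _)
  rw [hu, ← sum_Iic_symm, ← sum_Iic_symm]
  refine mul_left_cancel₀ (hwpos _ (hα _) fun j hj => ?_).ne' hterm
  rw [Function.comp_apply, Function.comp_apply, Equiv.apply_symm_apply]
  refine hT u (hu ▸ Finset.mem_insert_self _ _) _ ?_
  rw [hu, Finset.mem_insert, mem_earlier, Equiv.symm_apply_apply, ← Equiv.eq_symm_apply]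
  exact not_or.2 ⟨hj.ne', hj.not_gt⟩

end LevelSets

variable [Fintype ι] [DecidableEq ι]

/-- The sum rate `log₂ (det (A + ∑ k ∈ T, p_k h_k h_kᴴ) / det A)` of the users in `T` in the dual
multiple access channel when all other users are silent: a submodular function of `T`. -/
noncomputable def groupRate (A : Matrix ι ι ℂ) (h : Fin K → ι → ℂ) (p : Fin K → ℝ)
    (T : Finset (Fin K)) : ℝ :=
  Real.logb 2 ((macCov A h 1 p T).det.re / A.det.re)

/-- The rate of user `u` in the dual multiple access channel in the presence of the users in `T`,
which for `u ∉ T` is the increment of `groupRate`. -/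
noncomputable def marginalRate (A : Matrix ι ι ℂ) (h : Fin K → ι → ℂ) (p : Fin K → ℝ)
    (T : Finset (Fin K)) (u : Fin K) : ℝ :=
  Real.logb 2 (1 + p u * rxPower (h u) (macCov A h 1 p T)⁻¹)

variable {A : Matrix ι ι ℂ} {h : Fin K → ι → ℂ} {p : Fin K → ℝ} {T T' : Finset (Fin K)}

lemma groupRate_empty (hA : A.PosDef) : groupRate A h p ∅ = 0 := by
  have hdet : A.det.re ≠ 0 := (re_det_pos hA).ne'
  simp [groupRate, macCov, div_self hdet]

lemma one_add_mul_rxPower_inv_pos (hA : A.PosDef) (hp : ∀ i, 0 ≤ p i) (T : Finset (Fin K))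
    (u : Fin K) : 0 < 1 + p u * rxPower (h u) (macCov A h 1 p T)⁻¹ :=
  add_pos_of_pos_of_nonneg one_pos
    (mul_nonneg (hp u) (rxPower_nonneg _ (posDef_macCov hA h 1 hp T).inv.posSemidef))

lemma groupRate_insert (hA : A.PosDef) (hp : ∀ i, 0 ≤ p i) {u : Fin K} (hu : u ∉ T) :
    groupRate A h p (insert u T) = groupRate A h p T + marginalRate A h p T u := by
  have hM := posDef_macCov hA h 1 hp T
  have hdet : 0 < (macCov A h 1 p T).det.re / A.det.re := div_pos (re_det_pos hM) (re_det_pos hA)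
  rw [groupRate, groupRate, marginalRate, macCov_insert A h 1 p hu, Equiv.Perm.one_apply,
    re_det_add_smul_vecMulVec hM, mul_div_right_comm,
    Real.logb_mul hdet.ne' (one_add_mul_rxPower_inv_pos hA hp T u).ne']

lemma macRate_eq_marginalRate (hA : A.PosDef) (hp : ∀ i, 0 ≤ p i) (π : Equiv.Perm (Fin K))
    (u : Fin K) : macRate A h π p u = marginalRate A h p (earlier π u) u := by
  rw [macRate, macRateAt_eq_logb hA hp, macGain, Equiv.apply_symm_apply, marginalRate,
    macCov_one_earlier]

lemma marginalRate_antitone (hA : A.PosDef) (hp : ∀ i, 0 ≤ p i) (hT : T ⊆ T') (u : Fin K) :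
    marginalRate A h p T' u ≤ marginalRate A h p T u := by
  have hM := posDef_macCov hA h 1 hp T
  have hN := posDef_macCov hA h 1 hp T'
  have hgain := rxPower_inv_sub_rxPower_inv hM hN (h u)
  have hx := rxPower_nonneg ((macCov A h 1 p T)⁻¹ *ᵥ h u - (macCov A h 1 p T')⁻¹ *ᵥ h u)
    hM.posSemidef
  have hy : 0 ≤ rxPower ((macCov A h 1 p T')⁻¹ *ᵥ h u)
      (macCov A h 1 p T' - macCov A h 1 p T) := by
    rw [rxPower_macCov_one_sub A h p hT]
    exact Finset.sum_nonneg fun v _ => mul_nonneg (hp v) (sq_nonneg _)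
  have hle : rxPower (h u) (macCov A h 1 p T')⁻¹ ≤ rxPower (h u) (macCov A h 1 p T)⁻¹ := by
    linarith
  exact Real.logb_le_logb_of_le one_lt_two (one_add_mul_rxPower_inv_pos hA hp T' u)
    (add_le_add_right (mul_le_mul_of_nonneg_left hle (hp u)) 1)

lemma inv_mulVec_eq_of_marginalRate_eq (hA : A.PosDef) (hp : ∀ i, 0 ≤ p i) (hT : T ⊆ T')
    {u : Fin K} (hu : p u ≠ 0) (heq : marginalRate A h p T' u = marginalRate A h p T u) :
    (macCov A h 1 p T)⁻¹ *ᵥ h u = (macCov A h 1 p T')⁻¹ *ᵥ h u ∧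
      ∀ v ∈ T', v ∉ T → p v ≠ 0 → star ((macCov A h 1 p T')⁻¹ *ᵥ h u) ⬝ᵥ h v = 0 := by
  have hM := posDef_macCov hA h 1 hp T
  have hgain := rxPower_inv_sub_rxPower_inv hM (posDef_macCov hA h 1 hp T') (h u)
  have harg := Real.logb_injOn_pos one_lt_two (one_add_mul_rxPower_inv_pos hA hp T' u)
    (one_add_mul_rxPower_inv_pos hA hp T u) heq
  rw [← mul_left_cancel₀ hu (add_left_cancel harg), sub_self,
    rxPower_macCov_one_sub A h p hT] at hgain
  have hterms : ∀ v ∈ T' \ T, 0 ≤ p v * ‖star ((macCov A h 1 p T')⁻¹ *ᵥ h u) ⬝ᵥ h v‖ ^ 2 :=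
    fun v _ => mul_nonneg (hp v) (sq_nonneg _)
  obtain ⟨hx, hy⟩ := (add_eq_zero_iff_of_nonneg (rxPower_nonneg _ hM.posSemidef)
    (Finset.sum_nonneg hterms)).1 hgain.symm
  refine ⟨sub_eq_zero.1 ?_, fun v hv' hv hpv => ?_⟩
  · by_contra hne
    exact (rxPower_pos hne hM).ne' hx
  · simpa [hpv] using
      (Finset.sum_eq_zero_iff_of_nonneg hterms).1 hy v (Finset.mem_sdiff.2 ⟨hv', hv⟩)

lemma sum_marginalRate_inter_earlier (hA : A.PosDef) (hp : ∀ i, 0 ≤ p i) (τ : Equiv.Perm (Fin K))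
    (T : Finset (Fin K)) :
    ∑ u ∈ T, marginalRate A h p (T ∩ earlier τ u) u = groupRate A h p T := by
  induction T using Finset.induction_on_max_value τ.symm with
  | empty => rw [Finset.sum_empty, groupRate_empty hA]
  | insert u T hu hmax ih =>
    have hlt : T ⊆ earlier τ u := fun v hv => mem_earlier.2 <|
      (hmax v hv).lt_of_ne fun heq => hu (τ.symm.injective heq ▸ hv)
    have hold : ∀ v ∈ T, insert u T ∩ earlier τ v = T ∩ earlier τ v := fun v hv =>
      Finset.insert_inter_of_notMem (by simpa using hmax v hv)
    rw [Finset.sum_insert hu, Finset.insert_inter_of_notMem (by simp),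
      Finset.inter_eq_left.2 hlt, Finset.sum_congr rfl fun v hv => by rw [hold v hv], ih,
      groupRate_insert hA hp hu, add_comm]

lemma sum_macRate_le_groupRate (hA : A.PosDef) (hp : ∀ i, 0 ≤ p i) (τ : Equiv.Perm (Fin K))
    (T : Finset (Fin K)) : ∑ u ∈ T, macRate A h τ p u ≤ groupRate A h p T := by
  rw [← sum_marginalRate_inter_earlier hA hp τ]
  refine Finset.sum_le_sum fun u _ => ?_
  rw [macRate_eq_marginalRate hA hp]
  exact marginalRate_antitone hA hp Finset.inter_subset_right u

lemma marginalRate_inter_earlier_of_sum_eq (hA : A.PosDef) (hp : ∀ i, 0 ≤ p i)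
    {τ : Equiv.Perm (Fin K)} (heq : ∑ u ∈ T, macRate A h τ p u = groupRate A h p T)
    {u : Fin K} (hu : u ∈ T) :
    marginalRate A h p (T ∩ earlier τ u) u = marginalRate A h p (earlier τ u) u := by
  rw [← sum_marginalRate_inter_earlier hA hp τ] at heq
  rw [← macRate_eq_marginalRate hA hp]
  refine ((Finset.sum_eq_sum_iff_of_le fun u _ => ?_).1 heq u hu).symm
  rw [macRate_eq_marginalRate hA hp]
  exact marginalRate_antitone hA hp Finset.inter_subset_right u

lemma sum_macRate_insert_earlier (hA : A.PosDef) (hp : ∀ i, 0 ≤ p i) (π : Equiv.Perm (Fin K))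
    (u : Fin K) :
    ∑ v ∈ insert u (earlier π u), macRate A h π p v
      = groupRate A h p (insert u (earlier π u)) := by
  rw [← sum_marginalRate_inter_earlier hA hp π]
  refine Finset.sum_congr rfl fun v hv => ?_
  have hsub : earlier π v ⊆ insert u (earlier π u) := fun w hw => by
    rw [mem_earlier] at hw
    rw [Finset.mem_insert, mem_earlier] at hv ⊢
    rcases hv with rfl | hv
    exacts [.inr hw, .inr (hw.trans hv)]
  rw [macRate_eq_marginalRate hA hp, Finset.inter_eq_right.2 hsub]

lemma sum_macRate_eq_groupRate (hA : A.PosDef) (hp : ∀ i, 0 ≤ p i) {α : Fin K → ℝ}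
    {π : Equiv.Perm (Fin K)} (hπ : Antitone (α ∘ π)) (hT : ∀ u ∈ T, ∀ v ∉ T, α v < α u) :
    ∑ u ∈ T, macRate A h π p u = groupRate A h p T := by
  rcases T.eq_empty_or_nonempty with rfl | hne
  · rw [Finset.sum_empty, groupRate_empty hA]
  obtain ⟨u, rfl⟩ := exists_eq_insert_earlier hπ hne hT
  exact sum_macRate_insert_earlier hA hp π u

section Orders

variable {α : Fin K → ℝ} {π τ : Equiv.Perm (Fin K)}

lemma sum_insert_earlier_macRate_le (hA : A.PosDef) (hp : ∀ i, 0 ≤ p i)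
    (π τ : Equiv.Perm (Fin K)) (u : Fin K) :
    ∑ v ∈ insert u (earlier π u), macRate A h τ p v
      ≤ ∑ v ∈ insert u (earlier π u), macRate A h π p v :=
  (sum_macRate_le_groupRate hA hp τ _).trans_eq (sum_macRate_insert_earlier hA hp π u).symm

lemma sum_mul_macRate_le (hA : A.PosDef) (hp : ∀ i, 0 ≤ p i) (hα : ∀ i, 0 ≤ α i)
    (hπ : Antitone (α ∘ π)) (τ : Equiv.Perm (Fin K)) :
    ∑ u, α u * macRate A h τ p u ≤ ∑ u, α u * macRate A h π p u :=
  sum_mul_le_sum_mul hα hπ fun u => sum_insert_earlier_macRate_le hA hp π τ u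

lemma macRate_eq_of_sum_mul_eq (hA : A.PosDef) (hp : ∀ i, 0 ≤ p i) (hα : ∀ i, 0 < α i)
    (hinj : α.Injective) (hπ : Antitone (α ∘ π))
    (heq : ∑ u, α u * macRate A h τ p u = ∑ u, α u * macRate A h π p u) (u : Fin K) :
    macRate A h τ p u = macRate A h π p u := by
  have hlt (v w : Fin K) (hvw : π.symm v < π.symm w) : α w < α v := by
    refine lt_of_le_of_ne ?_ (hinj.ne fun heq => hvw.ne (congrArg _ heq.symm))
    simpa using hπ hvw.le
  have hsum {T : Finset (Fin K)} (hT : ∀ u ∈ T, ∀ v ∉ T, α v < α u) :=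
    sum_eq_sum_of_sum_mul_eq hα hπ (fun u => sum_insert_earlier_macRate_le hA hp π τ u) heq hT
  have hbefore := hsum (T := earlier π u) fun v hv w hw => by
    rw [mem_earlier] at hv hw
    exact hlt _ _ (hv.trans_le (not_lt.1 hw))
  have hupto := hsum (T := insert u (earlier π u)) fun v hv w hw => by
    simp only [Finset.mem_insert, mem_earlier, not_or, not_lt] at hv hw
    have huw := hw.2.lt_of_ne fun heq => hw.1 (π.symm.injective heq.symm)
    rcases hv with rfl | hv
    exacts [hlt _ _ huw, hlt _ _ (hv.trans huw)]
  rwa [Finset.sum_insert (by simp), Finset.sum_insert (by simp), hbefore, add_left_inj] at hupto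

lemma star_inv_macCov_mulVec_dotProduct_eq_zero (hA : A.PosDef) (hp : ∀ i, 0 ≤ p i)
    (hα : ∀ i, 0 < α i) (hinj : α.Injective) (hπ : Antitone (α ∘ π))
    (heq : ∑ u, α u * macRate A h τ p u = ∑ u, α u * macRate A h π p u) {u v : Fin K}
    (hu : p u ≠ 0) (hv : p v ≠ 0) (hvπ : v ∈ earlier π u) (hvτ : v ∉ earlier τ u) :
    star ((macCov A h 1 p (earlier τ u))⁻¹ *ᵥ h u) ⬝ᵥ h v = 0 := by
  have hrate := macRate_eq_of_sum_mul_eq hA hp hα hinj hπ heq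
  have hgroup : ∑ w ∈ insert u (earlier π u), macRate A h τ p w
      = groupRate A h p (insert u (earlier π u)) := by
    rw [Finset.sum_congr rfl fun w _ => hrate w, sum_macRate_insert_earlier hA hp]
  have hinter := marginalRate_inter_earlier_of_sum_eq hA hp hgroup (Finset.mem_insert_self _ _)
  rw [Finset.insert_inter_of_notMem (by simp)] at hinter
  have hmarginal : marginalRate A h p (earlier π u) u
      = marginalRate A h p (earlier π u ∩ earlier τ u) u := by
    rw [hinter, ← macRate_eq_marginalRate hA hp, ← macRate_eq_marginalRate hA hp, hrate]
  obtain ⟨hπinter, horth⟩ :=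
    inv_mulVec_eq_of_marginalRate_eq hA hp Finset.inter_subset_left hu hmarginal
  have hτinter :=
    (inv_mulVec_eq_of_marginalRate_eq hA hp Finset.inter_subset_right hu hinter.symm).1
  rw [← hτinter, hπinter]
  exact horth v hvπ (fun hmem => hvτ (Finset.mem_of_mem_inter_right hmem)) hv

end Orders

end Polymatroid

/-! ### Optimal powers of the multiple access channel -/

section MacOptimal

lemma sum_levelSet_eq_zero {κ R E : Type*} [Fintype κ] [LinearOrder R] [AddCommGroup E]
    {α : κ → R} {f : κ → E}
    (hf : ∀ T : Finset κ, (∀ u ∈ T, ∀ v ∉ T, α v < α u) → ∑ u ∈ T, f u = 0) (c : R) :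
    ∑ u with α u = c, f u = 0 := by
  classical
  have habove := hf {u | c < α u} fun u hu v hv => by
    simp only [Finset.mem_filter_univ, not_lt] at hu hv
    exact hv.trans_lt hu
  have hatLeast := hf {u | c ≤ α u} fun u hu v hv => by
    simp only [Finset.mem_filter_univ, not_le] at hu hv
    exact hv.trans_le hu
  have hsplit : Finset.univ.filter (c ≤ α ·)
      = Finset.univ.filter (c < α ·) ∪ Finset.univ.filter (α · = c) := by
    ext u
    simp [le_iff_lt_or_eq, eq_comm]
  rwa [hsplit, Finset.sum_union (Finset.disjoint_filter.2 fun u _ hlt heq => hlt.ne' heq), habove,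
    zero_add] at hatLeast

variable {ι : Type*} {K : ℕ} {nv P : ℝ}

lemma isCompact_macFeasible (hnv : 0 < nv) (P : ℝ) : IsCompact (macFeasible K nv P) := by
  refine (isCompact_Icc (a := (0 : Fin K → ℝ)) (b := fun _ => P / nv)).of_isClosed_subset ?_ ?_
  · rw [macFeasible, Set.ofPred_and, Set.ofPred_forall]
    exact (isClosed_iInter fun i => isClosed_le continuous_const (continuous_apply i)).inter
      (isClosed_le (by fun_prop) continuous_const)
  · rintro p ⟨hp, hsum⟩
    refine ⟨hp, fun i => ?_⟩
    rw [le_div_iff₀ hnv, mul_comm]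
    exact (mul_le_mul_of_nonneg_left
      (Finset.single_le_sum (fun k _ => hp k) (Finset.mem_univ i)) hnv.le).trans hsum

lemma macCov_one_sub_macCov_one (A : Matrix ι ι ℂ) (h : Fin K → ι → ℂ) (p q : Fin K → ℝ)
    (T : Finset (Fin K)) :
    macCov A h 1 q T - macCov A h 1 p T
      = ∑ u ∈ T, ((q u - p u : ℝ) : ℂ) • vecMulVec (h u) (star (h u)) := by
  simp only [macCov, add_sub_add_left_eq_sub, ← Finset.sum_sub_distrib, ← sub_smul,
    Equiv.Perm.one_apply, Complex.ofReal_sub]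

lemma macCov_one_add_macCov_one (A : Matrix ι ι ℂ) (h : Fin K → ι → ℂ) {p q m : Fin K → ℝ}
    (hm : p + q = m + m) (T : Finset (Fin K)) :
    macCov A h 1 p T + macCov A h 1 q T = macCov A h 1 m T + macCov A h 1 m T := by
  have hterm (v : Fin K) : (p v : ℂ) + q v = m v + m v := mod_cast congrFun hm v
  simp only [macCov, add_add_add_comm A, ← Finset.sum_add_distrib, ← add_smul, hterm,
    Equiv.Perm.one_apply]

lemma macCov_update_of_channel_eq_zero (A : Matrix ι ι ℂ) {h : Fin K → ι → ℂ}
    (π : Equiv.Perm (Fin K)) (p : Fin K → ℝ) {u : Fin K} (hu : h u = 0) (c : ℝ)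
    (s : Finset (Fin K)) : macCov A h π (Function.update p u c) s = macCov A h π p s := by
  rw [macCov, macCov]
  refine congrArg (A + ·) (Finset.sum_congr rfl fun k _ => ?_)
  rcases eq_or_ne (π k) u with rfl | hk
  · simp [hu]
  · rw [Function.update_of_ne hk]

variable [Fintype ι] [DecidableEq ι] {A : Matrix ι ι ℂ} {h : Fin K → ι → ℂ} {p q : Fin K → ℝ}
  {T : Finset (Fin K)}

lemma exists_isMacOptimal (α : Fin K → ℝ) (hnv : 0 < nv) (hA : A.PosDef) (h : Fin K → ι → ℂ)
    (hP : 0 ≤ P) (π : Equiv.Perm (Fin K)) : ∃ p, IsMacOptimal α nv A h P π p := by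
  have hdet (s : Finset (Fin K)) : Continuous fun p : Fin K → ℝ => (macCov A h π p s).det.re := by
    refine Complex.continuous_re.comp (Continuous.matrix_det ?_)
    unfold macCov
    fun_prop
  have hpos {p : Fin K → ℝ} (hp : p ∈ macFeasible K nv P) (s : Finset (Fin K)) :
      0 < (macCov A h π p s).det.re := re_det_pos (posDef_macCov hA h π hp.1 s)
  refine (isCompact_macFeasible hnv P).exists_isMaxOn ⟨0, fun _ => le_rfl, by simpa using hP⟩ <|
    continuousOn_finsetSum _ fun j _ => continuousOn_const.mul ?_
  unfold macRate macRateAt Real.logb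
  refine (ContinuousOn.log ?_ fun p hp => ?_).div_const _
  · exact (hdet _).continuousOn.div (hdet _).continuousOn fun p hp => (hpos hp _).ne'
  · exact (div_pos (hpos hp _) (hpos hp _)).ne'

lemma groupRate_eq_log_sub_log_div (hA : A.PosDef) (hp : ∀ i, 0 ≤ p i) (T : Finset (Fin K)) :
    groupRate A h p T
      = (Real.log (macCov A h 1 p T).det.re - Real.log A.det.re) / Real.log 2 := by
  have hM : 0 < (macCov A h 1 p T).det.re := re_det_pos (posDef_macCov hA h 1 hp T)
  have hdet : 0 < A.det.re := re_det_pos hA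
  rw [groupRate, Real.logb, Real.log_div hM.ne' hdet.ne']

lemma groupRate_lt_groupRate_of_ne (hA : A.PosDef) (hp : ∀ i, 0 ≤ p i) (hpq : p ≤ q)
    (hne : macCov A h 1 p T ≠ macCov A h 1 q T) : groupRate A h p T < groupRate A h q T := by
  have hsub : (macCov A h 1 q T - macCov A h 1 p T).PosSemidef := by
    rw [macCov_one_sub_macCov_one]
    exact posSemidef_sum _ fun u _ => posSemidef_ofReal_smul_vecMulVec (sub_nonneg.2 (hpq u)) _
  rw [groupRate_eq_log_sub_log_div hA hp,
    groupRate_eq_log_sub_log_div hA fun i => (hp i).trans (hpq i)]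
  exact div_lt_div_of_pos_right
    (sub_lt_sub_right (log_det_lt_log_det (posDef_macCov hA h 1 hp T) hsub hne) _)
    (Real.log_pos one_lt_two)

lemma groupRate_le_groupRate (hA : A.PosDef) (hp : ∀ i, 0 ≤ p i) (hpq : p ≤ q)
    (T : Finset (Fin K)) : groupRate A h p T ≤ groupRate A h q T := by
  rcases eq_or_ne (macCov A h 1 p T) (macCov A h 1 q T) with heq | hne
  · rw [groupRate, groupRate, heq]
  · exact (groupRate_lt_groupRate_of_ne hA hp hpq hne).le

lemma groupRate_lt_groupRate (hA : A.PosDef) (hp : ∀ i, 0 ≤ p i) (hpq : p ≤ q) {u : Fin K}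
    (hu : u ∈ T) (hh : h u ≠ 0) (hlt : p u < q u) : groupRate A h p T < groupRate A h q T := by
  refine groupRate_lt_groupRate_of_ne hA hp hpq fun heq => ?_
  have hzero := congrArg (rxPower (h u)) (macCov_one_sub_macCov_one A h p q T)
  simp only [heq, sub_self, rxPower_sum, rxPower_ofReal_smul, rxPower_vecMulVec_star_self] at hzero
  have hterm := (Finset.sum_eq_zero_iff_of_nonneg fun v _ =>
    mul_nonneg (sub_nonneg.2 (hpq v)) (sq_nonneg _)).1 (hzero.symm.trans (by simp [rxPower])) u hu
  have hself : star (h u) ⬝ᵥ h u ≠ 0 := by simpa using hh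
  exact (mul_pos (sub_pos.2 hlt) (pow_pos (norm_pos_iff.2 hself) 2)).ne' hterm

lemma groupRate_add_groupRate_lt (hA : A.PosDef) {m : Fin K → ℝ} (hp : ∀ i, 0 ≤ p i)
    (hq : ∀ i, 0 ≤ q i) (hm : p + q = m + m) (hne : macCov A h 1 p T ≠ macCov A h 1 q T) :
    groupRate A h p T + groupRate A h q T < 2 * groupRate A h m T := by
  have hm0 (i : Fin K) : 0 ≤ m i := by
    have := congrFun hm i
    simp only [Pi.add_apply] at this
    linarith [hp i, hq i]
  have hlog := log_det_add_log_det_lt (posDef_macCov hA h 1 hp T) (posDef_macCov hA h 1 hq T)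
    (macCov_one_add_macCov_one A h hm T) hne
  simp only [RCLike.re_eq_complex_re] at hlog
  rw [groupRate_eq_log_sub_log_div hA hp, groupRate_eq_log_sub_log_div hA hq,
    groupRate_eq_log_sub_log_div hA hm0, ← add_div, mul_div_assoc']
  exact div_lt_div_of_pos_right (by linarith) (Real.log_pos one_lt_two)

lemma groupRate_add_groupRate_le (hA : A.PosDef) {m : Fin K → ℝ} (hp : ∀ i, 0 ≤ p i)
    (hq : ∀ i, 0 ≤ q i) (hm : p + q = m + m) (T : Finset (Fin K)) :
    groupRate A h p T + groupRate A h q T ≤ 2 * groupRate A h m T := by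
  rcases eq_or_ne (macCov A h 1 p T) (macCov A h 1 q T) with heq | hne
  · have hcov := macCov_one_add_macCov_one A h hm T
    rw [← heq, ← two_smul ℂ, ← two_smul ℂ (macCov A h 1 m T)] at hcov
    have hmid := smul_right_injective _ (two_ne_zero (α := ℂ)) hcov
    rw [groupRate, groupRate, groupRate, ← heq, ← hmid, two_mul]
  · exact (groupRate_add_groupRate_lt hA hp hq hm hne).le

namespace IsMacOptimal

variable {α : Fin K → ℝ} {π : Equiv.Perm (Fin K)}

lemma mul_sum_eq (hp : IsMacOptimal α nv A h P π p) (hα : ∀ i, 0 < α i) (hnv : 0 < nv)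
    (hA : A.PosDef) (hπ : Antitone (α ∘ π)) (hh : ∃ u, h u ≠ 0) : nv * ∑ u, p u = P := by
  obtain ⟨⟨hp0, hpP⟩, hmax⟩ := hp
  obtain ⟨u, hu⟩ := hh
  by_contra hne
  have : NeZero K := ⟨fun hK => (hK ▸ u).elim0⟩
  set δ := (P - nv * ∑ u, p u) / (nv * K) with hδ
  have hK : 0 < nv * (K : ℝ) := mul_pos hnv (Nat.cast_pos.2 (NeZero.pos K))
  have hδ0 : 0 < δ := div_pos (sub_pos.2 (hpP.lt_of_ne hne)) hK
  have hpq : p ≤ fun v => p v + δ := fun v => le_add_of_nonneg_right hδ0.le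
  have hq0 (v : Fin K) : 0 ≤ p v + δ := (hp0 v).trans (hpq v)
  have hfeasible : (fun v => p v + δ) ∈ macFeasible K nv P := by
    refine ⟨hq0, le_of_eq ?_⟩
    rw [Finset.sum_add_distrib, Finset.sum_const, Finset.card_univ, Fintype.card_fin,
      nsmul_eq_mul, mul_add, ← mul_assoc, hδ, mul_div_cancel₀ _ hK.ne']
    ring
  have hprefix (v : Fin K) : ∑ w ∈ insert v (earlier π v), macRate A h π p w
      ≤ ∑ w ∈ insert v (earlier π v), macRate A h π (fun v => p v + δ) w := by
    rw [sum_macRate_insert_earlier hA hp0, sum_macRate_insert_earlier hA hq0]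
    exact groupRate_le_groupRate hA hp0 hpq _
  have hgroup := sum_eq_sum_of_sum_mul_eq hα hπ hprefix
    ((sum_mul_le_sum_mul (fun i => (hα i).le) hπ hprefix).antisymm (hmax hfeasible))
    (T := Finset.univ) (by simp)
  rw [sum_macRate_eq_groupRate hA hp0 hπ (by simp),
    sum_macRate_eq_groupRate hA hq0 hπ (by simp)] at hgroup
  exact (groupRate_lt_groupRate hA hp0 hpq (Finset.mem_univ u) hu
    (lt_add_of_pos_right _ hδ0)).ne hgroup

lemma eq_zero_of_channel_eq_zero (hp : IsMacOptimal α nv A h P π p) (hα : ∀ i, 0 < α i)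
    (hnv : 0 < nv) (hA : A.PosDef) (hπ : Antitone (α ∘ π)) (hh : ∃ u, h u ≠ 0) {u : Fin K}
    (hu : h u = 0) : p u = 0 := by
  set p' := Function.update p u 0 with hp'
  have hrate : macRate A h π p' = macRate A h π p := funext fun v => by
    simp only [macRate, macRateAt, hp', macCov_update_of_channel_eq_zero A π p hu]
  have hp'p : p' ≤ p := update_le_self_iff.2 (hp.1.1 u)
  have hp'0 : 0 ≤ p' := le_update_iff.2 ⟨le_rfl, fun v _ => hp.1.1 v⟩
  have hopt : IsMacOptimal α nv A h P π p' := by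
    refine ⟨⟨hp'0, le_trans (mul_le_mul_of_nonneg_left (Finset.sum_le_sum fun v _ => hp'p v)
      hnv.le) hp.1.2⟩, fun q hq => ?_⟩
    simpa only [Set.mem_ofPred_eq, hrate] using hp.2 hq
  have hsum : ∑ v, p' v = ∑ v, p v := mul_left_cancel₀ hnv.ne' <|
    (hopt.mul_sum_eq hα hnv hA hπ hh).trans (hp.mul_sum_eq hα hnv hA hπ hh).symm
  rw [← (Finset.sum_eq_sum_iff_of_le fun v _ => hp'p v).1 hsum u (Finset.mem_univ u), hp',
    Function.update_self]

lemma macCov_one_eq (hp : IsMacOptimal α nv A h P π p) (hq : IsMacOptimal α nv A h P π q)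
    (hα : ∀ i, 0 < α i) (hA : A.PosDef) (hπ : Antitone (α ∘ π))
    (hT : ∀ u ∈ T, ∀ v ∉ T, α v < α u) : macCov A h 1 p T = macCov A h 1 q T := by
  set m : Fin K → ℝ := fun u => (p u + q u) / 2
  have hmid : p + q = m + m := funext fun u => (add_halves _).symm
  have hm0 (u : Fin K) : 0 ≤ m u := div_nonneg (add_nonneg (hp.1.1 u) (hq.1.1 u)) two_pos.le
  have hfeasible : m ∈ macFeasible K nv P := by
    refine ⟨hm0, ?_⟩
    rw [← Finset.sum_div, Finset.sum_add_distrib]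
    linarith [hp.1.2, hq.1.2]
  have hprefix (u : Fin K) :
      ∑ v ∈ insert u (earlier π u), (macRate A h π p v + macRate A h π q v)
        ≤ ∑ v ∈ insert u (earlier π u), 2 * macRate A h π m v := by
    rw [Finset.sum_add_distrib, ← Finset.mul_sum, sum_macRate_insert_earlier hA hp.1.1,
      sum_macRate_insert_earlier hA hq.1.1, sum_macRate_insert_earlier hA hm0]
    exact groupRate_add_groupRate_le hA hp.1.1 hq.1.1 hmid _
  have hvalue : ∑ u, α u * (macRate A h π p u + macRate A h π q u)
      = ∑ u, α u * (2 * macRate A h π m u) := by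
    refine (sum_mul_le_sum_mul (fun i => (hα i).le) hπ hprefix).antisymm ?_
    have hmp : ∑ u, α u * macRate A h π m u ≤ ∑ u, α u * macRate A h π p u := hp.2 hfeasible
    have hmq : ∑ u, α u * macRate A h π m u ≤ ∑ u, α u * macRate A h π q u := hq.2 hfeasible
    simp only [mul_add, Finset.sum_add_distrib, mul_left_comm _ (2 : ℝ), ← Finset.mul_sum]
    linarith
  have hgroup := sum_eq_sum_of_sum_mul_eq hα hπ hprefix hvalue hT
  rw [Finset.sum_add_distrib, ← Finset.mul_sum, sum_macRate_eq_groupRate hA hp.1.1 hπ hT,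
    sum_macRate_eq_groupRate hA hq.1.1 hπ hT, sum_macRate_eq_groupRate hA hm0 hπ hT] at hgroup
  by_contra hne
  exact (groupRate_add_groupRate_lt hA hp.1.1 hq.1.1 hmid hne).ne hgroup

lemma unique (hp : IsMacOptimal α nv A h P π p) (hq : IsMacOptimal α nv A h P π q)
    (hα : ∀ i, 0 < α i) (hnv : 0 < nv) (hA : A.PosDef) (hπ : Antitone (α ∘ π))
    (hh : ∃ u, h u ≠ 0)
    (hind : ∀ c : ℝ, LinearIndepOn ℝ (fun u => vecMulVec (h u) (star (h u)))
      {u | α u = c ∧ h u ≠ 0}) : p = q := by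
  classical
  funext u
  rcases eq_or_ne (h u) 0 with hu | hu
  · rw [hp.eq_zero_of_channel_eq_zero hα hnv hA hπ hh hu,
      hq.eq_zero_of_channel_eq_zero hα hnv hA hπ hh hu]
  have hupper (T : Finset (Fin K)) (hT : ∀ v ∈ T, ∀ w ∉ T, α w < α v) :
      ∑ v ∈ T, (q v - p v) • vecMulVec (h v) (star (h v)) = 0 := by
    have hsub := macCov_one_sub_macCov_one A h p q T
    rw [← hp.macCov_one_eq hq hα hA hπ hT, sub_self] at hsub
    simpa only [Complex.coe_smul] using hsub.symm
  have hclass : ∑ v with α v = α u ∧ h v ≠ 0, (q v - p v) • vecMulVec (h v) (star (h v)) = 0 := by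
    rw [← sum_levelSet_eq_zero hupper (α u), ← Finset.filter_filter]
    refine Finset.sum_filter_of_ne fun v _ hv hv0 => hv ?_
    rw [hv0, zero_vecMulVec, smul_zero]
  have hdiff := (linearIndepOn_finset_iff (s := {v | α v = α u ∧ h v ≠ 0})).1
    (by simpa using hind (α u)) (fun v => q v - p v) hclass u (by simp [hu])
  exact (sub_eq_zero.1 hdiff).symm

end IsMacOptimal

end MacOptimal

/-! ### Optimal points of the broadcast channel -/

section Broadcast

variable {ι : Type*} [Fintype ι] {K : ℕ} {nv P : ℝ} {A : Matrix ι ι ℂ} {h : Fin K → ι → ℂ}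
  {C : (Fin K → Matrix ι ι ℂ) → Set (Fin K → ℝ)} {S : Fin K → Matrix ι ι ℂ} {r : Fin K → ℝ}
  {x : (Fin K → Matrix ι ι ℂ) × (Fin K → ℝ)} {α p q : Fin K → ℝ} {π τ : Equiv.Perm (Fin K)}

lemma exists_antitone_comp_perm (α : Fin K → ℝ) :
    ∃ π : Equiv.Perm (Fin K), Antitone (α ∘ π) :=
  ⟨Tuple.sort (-α), fun _ _ hij => neg_le_neg_iff.1 (Tuple.monotone_sort (-α) hij)⟩

lemma wsrFeasible_mono {C' : (Fin K → Matrix ι ι ℂ) → Set (Fin K → ℝ)} (hC : ∀ S, C S ⊆ C' S)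
    (A : Matrix ι ι ℂ) (P : ℝ) : wsrFeasible C A P ⊆ wsrFeasible C' A P :=
  fun _ hx => ⟨hC _ hx.1, hx.2⟩

lemma orderRegion_subset_bcRegion (nv : ℝ) (h : Fin K → ι → ℂ) (π : Equiv.Perm (Fin K))
    (S : Fin K → Matrix ι ι ℂ) : orderRegion nv h π S ⊆ bcRegion nv h S :=
  Set.subset_iUnion (fun π => orderRegion nv h π S) π

lemma mem_wsrFeasible_bcRegion :
    x ∈ wsrFeasible (bcRegion nv h) A P ↔ ∃ τ, x ∈ wsrFeasible (orderRegion nv h τ) A P := by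
  simp [wsrFeasible, bcRegion]

lemma bcNoise_symm (nv : ℝ) (h : Fin K → ι → ℂ) (S : Fin K → Matrix ι ι ℂ)
    (π : Equiv.Perm (Fin K)) (u : Fin K) :
    bcNoise nv h S π (π.symm u) = nv + ∑ v with u ∈ earlier π v, rxPower (h u) (S v) := by
  rw [bcNoise_eq_add_sum, Equiv.apply_symm_apply]
  exact congrArg (nv + ·) (Finset.sum_equiv π (by simp) fun _ _ => rfl)

section Duality

variable [DecidableEq ι]

namespace IsMmseCovariance

lemma rank_le_one (hS : IsMmseCovariance nv A h S π p) (u : Fin K) : (S u).rank ≤ 1 := by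
  obtain ⟨i, rfl⟩ := π.surjective u
  rw [hS i, ← smul_vecMulVec]
  exact rank_vecMulVec_le _ _

lemma eq {S' : Fin K → Matrix ι ι ℂ} (hS : IsMmseCovariance nv A h S π p)
    (hS' : IsMmseCovariance nv A h S' π p) : S = S' := by
  funext u
  obtain ⟨i, rfl⟩ := π.surjective u
  induction i using WellFoundedGT.induction with
  | ind i ih =>
    have hnoise : bcNoise nv h S π i = bcNoise nv h S' π i := by
      rw [bcNoise, bcNoise, Finset.sum_congr rfl fun k hk => ih k (Finset.mem_Ioi.1 hk)]
    rw [hS i, hS' i, hnoise]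

lemma rxPower_eq_zero (hS : IsMmseCovariance nv A h S π p) {u : Fin K} {g : ι → ℂ}
    (hug : p u ≠ 0 → star ((macCov A h 1 p (earlier π u))⁻¹ *ᵥ h u) ⬝ᵥ g = 0) :
    rxPower g (S u) = 0 := by
  have hSu := hS (π.symm u)
  rw [Equiv.apply_symm_apply, ← macCov_one_earlier] at hSu
  rw [hSu, rxPower_ofReal_smul, rxPower_vecMulVec_star_self]
  by_cases hu : p u = 0
  · rw [hu, zero_mul, zero_div, zero_mul]
  · rw [star_dotProduct, hug hu, star_zero, norm_zero, zero_pow two_ne_zero, mul_zero]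

lemma bcNoise_le_bcNoise (hS : IsMmseCovariance nv A h S τ p) (hS0 : ∀ i, (S i).PosSemidef)
    (hA : A.PosDef) (hp : ∀ i, 0 ≤ p i) (hα : ∀ i, 0 < α i) (hinj : α.Injective)
    (hπ : Antitone (α ∘ π))
    (heq : ∑ u, α u * macRate A h τ p u = ∑ u, α u * macRate A h π p u) {u : Fin K}
    (hu : p u ≠ 0) : bcNoise nv h S π (π.symm u) ≤ bcNoise nv h S τ (τ.symm u) := by
  rw [bcNoise_symm, bcNoise_symm, ← Finset.sum_filter_ne_zero]
  refine add_le_add_right (Finset.sum_le_sum_of_subset_of_nonneg (fun v hv => ?_)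
    fun v _ _ => rxPower_nonneg _ (hS0 v)) nv
  simp only [Finset.mem_filter, Finset.mem_univ, true_and] at hv ⊢
  by_contra huτ
  exact hv.2 <| hS.rxPower_eq_zero fun hv0 =>
    star_inv_macCov_mulVec_dotProduct_eq_zero hA hp hα hinj hπ heq hv0 hu hv.1 huτ

lemma mem_orderRegion (hS : IsMmseCovariance nv A h S τ p) (hS0 : ∀ i, (S i).PosSemidef)
    (hnv : 0 < nv) (hA : A.PosDef) (hp : ∀ i, 0 ≤ p i) (hα : ∀ i, 0 < α i) (hinj : α.Injective)
    (hπ : Antitone (α ∘ π))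
    (heq : ∑ u, α u * macRate A h τ p u = ∑ u, α u * macRate A h π p u)
    (hr : r ∈ orderRegion nv h τ S) : r ∈ orderRegion nv h π S := by
  refine ⟨hr.1, fun i => ?_⟩
  obtain ⟨u, rfl⟩ := π.symm.surjective i
  have hτ := hr.2 (τ.symm u)
  have hrx := rxPower_nonneg (h u) (hS0 u)
  rw [dpcRate_eq_logb hnv h hS0, Equiv.apply_symm_apply] at hτ ⊢
  refine hτ.trans (Real.logb_le_logb_of_le one_lt_two ?_ (add_le_add_right ?_ 1))
  · exact add_pos_of_pos_of_nonneg one_pos (div_nonneg hrx (bcNoise_pos hnv h hS0 τ _).le)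
  by_cases hu : p u = 0
  · rw [hS.rxPower_eq_zero (absurd hu), zero_div, zero_div]
  · exact div_le_div_of_nonneg_left hrx (bcNoise_pos hnv h hS0 π _)
      (hS.bcNoise_le_bcNoise hS0 hA hp hα hinj hπ heq hu)

end IsMmseCovariance

lemma exists_macFeasible_isUplinkPower (hnv : 0 < nv) (hA : A.PosDef)
    (hx : (S, r) ∈ wsrFeasible (orderRegion nv h τ) A P) :
    ∃ p ∈ macFeasible K nv P, IsUplinkPower nv A h S τ p ∧ ∀ u, r u ≤ macRate A h τ p u := by
  obtain ⟨hr, htrace, hS⟩ := hx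
  obtain ⟨p, hp, hup⟩ := exists_isUplinkPower hnv hA h hS τ
  refine ⟨p, ⟨hp, (hup.mul_sum_le hnv hA hS hp).trans htrace⟩, hup, fun u => ?_⟩
  rw [macRate, hup.macRateAt_eq hnv hA hS hp]
  simpa using hr.2 (τ.symm u)

namespace IsDownlinkPower

lemma macRate_mem_orderRegion (hdown : IsDownlinkPower nv A h π p q) (hnv : 0 < nv)
    (hA : A.PosDef) (hp : ∀ i, 0 ≤ p i) (hq : ∀ i, 0 ≤ q i) :
    macRate A h π p ∈ orderRegion nv h π (beamCov A h π p q) := by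
  refine ⟨fun u => macRateAt_nonneg hA hp _, fun i => ?_⟩
  rw [hdown.dpcRate_beamCov hnv hA hp hq, macRate, Equiv.symm_apply_apply]

lemma mem_wsrFeasible (hdown : IsDownlinkPower nv A h π p q) (hnv : 0 < nv) (hA : A.PosDef)
    (hp : p ∈ macFeasible K nv P) (hq : ∀ i, 0 ≤ q i) :
    (beamCov A h π p q, macRate A h π p) ∈ wsrFeasible (orderRegion nv h π) A P :=
  ⟨hdown.macRate_mem_orderRegion hnv hA hp.1 hq,
    (hdown.re_sum_trace_le hnv hA hp.1 hq).trans hp.2, posSemidef_beamCov A h π p q⟩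

end IsDownlinkPower

namespace IsMacOptimal

lemma sum_mul_le (hp : IsMacOptimal α nv A h P π p) (hα : ∀ i, 0 ≤ α i) (hnv : 0 < nv)
    (hA : A.PosDef) (hπ : Antitone (α ∘ π)) (hx : x ∈ wsrFeasible (bcRegion nv h) A P) :
    ∑ u, α u * x.2 u ≤ ∑ u, α u * macRate A h π p u := by
  obtain ⟨τ, hτ⟩ := mem_wsrFeasible_bcRegion.1 hx
  obtain ⟨p', hp', -, hr⟩ := exists_macFeasible_isUplinkPower hnv hA hτ
  calc ∑ u, α u * x.2 u
      ≤ ∑ u, α u * macRate A h τ p' u :=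
        Finset.sum_le_sum fun u _ => mul_le_mul_of_nonneg_left (hr u) (hα u)
    _ ≤ ∑ u, α u * macRate A h π p' u := sum_mul_macRate_le hA hp'.1 hα hπ τ
    _ ≤ ∑ u, α u * macRate A h π p u := hp.2 hp'

lemma isWsrOptimal (hp : IsMacOptimal α nv A h P π p) (hα : ∀ i, 0 ≤ α i) (hnv : 0 < nv)
    (hA : A.PosDef) (hπ : Antitone (α ∘ π)) (hC : ∀ S, orderRegion nv h π S ⊆ C S)
    (hC' : ∀ S, C S ⊆ bcRegion nv h S) (hq : ∀ i, 0 ≤ q i)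
    (hdown : IsDownlinkPower nv A h π p q) :
    IsWsrOptimal α C A P (beamCov A h π p q, macRate A h π p) :=
  ⟨wsrFeasible_mono hC A P (hdown.mem_wsrFeasible hnv hA hp.1 hq),
    fun _ hx => hp.sum_mul_le hα hnv hA hπ (wsrFeasible_mono hC' A P hx)⟩

lemma le_sum_mul (hp : IsMacOptimal α nv A h P π p) (hnv : 0 < nv)
    (hA : A.PosDef) (hC : ∀ S, orderRegion nv h π S ⊆ C S) (hx : IsWsrOptimal α C A P x) :
    ∑ u, α u * macRate A h π p u ≤ ∑ u, α u * x.2 u := by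
  obtain ⟨q, hq, hdown⟩ := exists_isDownlinkPower hnv.le hA h π hp.1.1
  exact hx.2 (wsrFeasible_mono hC A P (hdown.mem_wsrFeasible hnv hA hp.1 hq))

lemma exists_isMmseCovariance (hp : IsMacOptimal α nv A h P π p)
    (hα : ∀ i, 0 < α i) (hnv : 0 < nv) (hA : A.PosDef) (hπ : Antitone (α ∘ π))
    (hh : ∃ u, h u ≠ 0) (hx : (S, r) ∈ wsrFeasible (orderRegion nv h τ) A P)
    (hval : ∑ u, α u * macRate A h π p u ≤ ∑ u, α u * r u) :
    ∃ p', IsMacOptimal α nv A h P π p' ∧ r = macRate A h τ p' ∧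
      ∑ u, α u * macRate A h τ p' u = ∑ u, α u * macRate A h π p' u ∧
      IsMmseCovariance nv A h S τ p' := by
  obtain ⟨p', hp', hup, hr⟩ := exists_macFeasible_isUplinkPower hnv hA hx
  have hterm (u : Fin K) : α u * r u ≤ α u * macRate A h τ p' u :=
    mul_le_mul_of_nonneg_left (hr u) (hα u).le
  have hrτ := Finset.sum_le_sum fun u (_ : u ∈ Finset.univ) => hterm u
  have hτπ := sum_mul_macRate_le (h := h) hA hp'.1 (fun i => (hα i).le) hπ τ
  have hmax : ∑ u, α u * macRate A h π p' u ≤ ∑ u, α u * macRate A h π p u := hp.2 hp'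
  have hopt : IsMacOptimal α nv A h P π p' :=
    ⟨hp', fun q hq => (hp.2 hq).trans (hval.trans (hrτ.trans hτπ))⟩
  refine ⟨p', hopt, funext fun u => mul_left_cancel₀ (hα u).ne' ?_, by linarith, ?_⟩
  · exact (Finset.sum_eq_sum_iff_of_le fun u _ => hterm u).1 (by linarith) u (Finset.mem_univ u)
  · refine hup.isMmseCovariance hnv hA hx.2.2 hp'.1 <|
      (hup.mul_sum_le hnv hA hx.2.2 hp'.1).antisymm ?_
    rw [hopt.mul_sum_eq hα hnv hA hπ hh]
    exact hx.2.1

end IsMacOptimal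

end Duality

lemma exists_isWsrOptimal (hα : ∀ i, 0 ≤ α i) (hnv : 0 < nv) (hA : A.PosDef) (hP : 0 ≤ P)
    (hπ : Antitone (α ∘ π)) (hC : ∀ S, orderRegion nv h π S ⊆ C S)
    (hC' : ∀ S, C S ⊆ bcRegion nv h S) : ∃ x, IsWsrOptimal α C A P x := by
  classical
  obtain ⟨p, hp⟩ := exists_isMacOptimal α hnv hA h hP π
  obtain ⟨q, hq, hdown⟩ := exists_isDownlinkPower hnv.le hA h π hp.1.1
  exact ⟨_, hp.isWsrOptimal hα hnv hA hπ hC hC' hq hdown⟩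

namespace IsWsrOptimal

lemma rank_le_one (hx : IsWsrOptimal α (bcRegion nv h) A P (S, r)) (hα : ∀ i, 0 < α i)
    (hnv : 0 < nv) (hA : A.PosDef) (hP : 0 ≤ P) (hh : ∃ u, h u ≠ 0) (u : Fin K) :
    (S u).rank ≤ 1 := by
  classical
  obtain ⟨π, hπ⟩ := exists_antitone_comp_perm α
  obtain ⟨p, hp⟩ := exists_isMacOptimal α hnv hA h hP π
  obtain ⟨τ, hτ⟩ := mem_wsrFeasible_bcRegion.1 hx.1
  obtain ⟨p', -, -, -, hS⟩ := hp.exists_isMmseCovariance hα hnv hA hπ hh hτ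
    (hp.le_sum_mul hnv hA (orderRegion_subset_bcRegion nv h π) hx)
  exact hS.rank_le_one u

lemma mem_orderRegion (hx : IsWsrOptimal α (bcRegion nv h) A P x) (hα : ∀ i, 0 < α i)
    (hnv : 0 < nv) (hA : A.PosDef) (hP : 0 ≤ P) (hh : ∃ u, h u ≠ 0) (hinj : α.Injective)
    (hπ : Antitone (α ∘ π)) : x.2 ∈ orderRegion nv h π x.1 := by
  classical
  obtain ⟨p, hp⟩ := exists_isMacOptimal α hnv hA h hP π
  obtain ⟨τ, hτ⟩ := mem_wsrFeasible_bcRegion.1 hx.1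
  obtain ⟨p', hp', -, heq, hS⟩ := hp.exists_isMmseCovariance hα hnv hA hπ hh hτ
    (hp.le_sum_mul hnv hA (orderRegion_subset_bcRegion nv h π) hx)
  exact hS.mem_orderRegion hx.1.2.2 hnv hA hp'.1.1 hα hinj hπ heq hτ.1

end IsWsrOptimal

lemma existsUnique_isWsrOptimal (hα : ∀ i, 0 < α i) (hnv : 0 < nv) (hA : A.PosDef)
    (hP : 0 ≤ P) (hh : ∃ u, h u ≠ 0) (hπ : Antitone (α ∘ π))
    (hind : ∀ c : ℝ, LinearIndepOn ℝ (fun u => vecMulVec (h u) (star (h u)))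
      {u | α u = c ∧ h u ≠ 0})
    (hC : ∀ S, orderRegion nv h π S ⊆ C S) (hC' : ∀ S, C S ⊆ bcRegion nv h S)
    (hmem : ∀ x, IsWsrOptimal α C A P x → x.2 ∈ orderRegion nv h π x.1) :
    ∃! x, IsWsrOptimal α C A P x := by
  classical
  obtain ⟨p, hp⟩ := exists_isMacOptimal α hnv hA h hP π
  refine existsUnique_of_exists_of_unique
    (exists_isWsrOptimal (fun i => (hα i).le) hnv hA hP hπ hC hC') fun x y hx hy => ?_
  obtain ⟨px, hpx, hrx, -, hSx⟩ := hp.exists_isMmseCovariance hα hnv hA hπ hh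
    ⟨hmem x hx, hx.1.2⟩ (hp.le_sum_mul hnv hA hC hx)
  obtain ⟨py, hpy, hry, -, hSy⟩ := hp.exists_isMmseCovariance hα hnv hA hπ hh
    ⟨hmem y hy, hy.1.2⟩ (hp.le_sum_mul hnv hA hC hy)
  obtain rfl := hpx.unique hpy hα hnv hA hπ hh hind
  exact Prod.ext (hSx.eq hSy) (hrx.trans hry.symm)

lemma existsUnique_isWsrOptimal_bcRegion (hα : ∀ i, 0 < α i) (hnv : 0 < nv) (hA : A.PosDef)
    (hP : 0 ≤ P) (hh : ∃ u, h u ≠ 0) (hinj : α.Injective) :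
    ∃! x, IsWsrOptimal α (bcRegion nv h) A P x := by
  obtain ⟨π, hπ⟩ := exists_antitone_comp_perm α
  refine existsUnique_isWsrOptimal hα hnv hA hP hh hπ (fun c => ?_)
    (orderRegion_subset_bcRegion nv h π) (fun _ => subset_rfl)
    fun x hx => hx.mem_orderRegion hα hnv hA hP hh hinj hπ
  have hsub : {u | α u = c ∧ h u ≠ 0}.Subsingleton :=
    fun u hu v hv => hinj (hu.1.trans hv.1.symm)
  rcases hsub.eq_empty_or_singleton with hempty | ⟨u, hu⟩
  · rw [hempty]
    exact linearIndepOn_empty _ _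
  · have hhu : h u ≠ 0 := (hu.symm ▸ Set.mem_singleton u : u ∈ {u | α u = c ∧ h u ≠ 0}).2
    rw [hu, linearIndepOn_singleton_iff]
    exact vecMulVec_ne_zero hhu (star_ne_zero.2 hhu)

lemma existsUnique_isWsrOptimal_orderRegion (hα : ∀ i, 0 < α i) (hnv : 0 < nv) (hA : A.PosDef)
    (hP : 0 ≤ P)
    (hind : ∀ c : ℝ, LinearIndepOn ℝ (fun u => vecMulVec (h u) (star (h u))) {u | α u = c})
    (hπ : Antitone (α ∘ π)) : ∃! x, IsWsrOptimal α (orderRegion nv h π) A P x := by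
  rcases isEmpty_or_nonempty (Fin K) with hK | ⟨⟨u⟩⟩
  · obtain ⟨x, hx⟩ := exists_isWsrOptimal (fun i => (hα i).le) hnv hA hP hπ (fun _ => subset_rfl)
      (orderRegion_subset_bcRegion nv h π)
    exact ⟨x, hx, fun y _ => Prod.ext (Subsingleton.elim _ _) (Subsingleton.elim _ _)⟩
  · have hu : h u ≠ 0 := fun h0 => (hind (α u)).ne_zero rfl (by simp [h0])
    exact existsUnique_isWsrOptimal hα hnv hA hP ⟨u, hu⟩ hπ
      (fun c => (hind c).mono fun v hv => hv.1) (fun _ => subset_rfl)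
      (orderRegion_subset_bcRegion nv h π) fun x hx => hx.1.1

end Broadcast

/-! ### Reduction to the range of the constraint matrix -/

section Compression

variable {ι μ : Type*} [Fintype ι] [Fintype μ] {K : ℕ} {nv P : ℝ} {U : Matrix ι μ ℂ}
  {A : Matrix μ μ ℂ} {h : Fin K → μ → ℂ} {S : Fin K → Matrix ι ι ℂ} {r : Fin K → ℝ}

lemma rxPower_mulVec (U : Matrix ι μ ℂ) (h : μ → ℂ) (S : Matrix ι ι ℂ) :
    rxPower (U *ᵥ h) S = rxPower h (Uᴴ * S * U) := by
  rw [rxPower, rxPower, star_mulVec, ← dotProduct_mulVec, mulVec_mulVec, mulVec_mulVec,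
    Matrix.mul_assoc]

lemma dpcRate_mulVec (nv : ℝ) (U : Matrix ι μ ℂ) (h : Fin K → μ → ℂ)
    (S : Fin K → Matrix ι ι ℂ) (π : Equiv.Perm (Fin K)) :
    dpcRate nv (fun i => U *ᵥ h i) S π = dpcRate nv h (fun i => Uᴴ * S i * U) π := by
  funext i
  simp only [dpcRate, rxPower_mulVec, Matrix.mul_sum, Matrix.sum_mul]

lemma mem_wsrFeasible_mulVec_iff (hS : ∀ i, (S i).PosSemidef) :
    (S, r) ∈ wsrFeasible (bcRegion nv fun i => U *ᵥ h i) (U * A * Uᴴ) P ↔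
      (fun i => Uᴴ * S i * U, r) ∈ wsrFeasible (bcRegion nv h) A P := by
  have htrace (i : Fin K) : (U * A * Uᴴ * S i).trace = (A * (Uᴴ * S i * U)).trace := by
    rw [Matrix.mul_assoc, Matrix.mul_assoc, trace_mul_comm, Matrix.mul_assoc, Matrix.mul_assoc]
  have hcompress (i : Fin K) : (Uᴴ * S i * U).PosSemidef := (hS i).conjTranspose_mul_mul_same U
  simp only [wsrFeasible, bcRegion, orderRegion, Set.mem_ofPred_eq, Set.mem_iUnion,
    dpcRate_mulVec, htrace, hS, hcompress, implies_true, and_true]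

lemma isWsrOptimal_mulVec_iff [DecidableEq μ] {α : Fin K → ℝ} (hU : Uᴴ * U = 1)
    (hS : ∀ i, (S i).PosSemidef) :
    IsWsrOptimal α (bcRegion nv fun i => U *ᵥ h i) (U * A * Uᴴ) P (S, r) ↔
      IsWsrOptimal α (bcRegion nv h) A P (fun i => Uᴴ * S i * U, r) := by
  refine and_congr (mem_wsrFeasible_mulVec_iff hS) ⟨fun hmax => ?_, fun hmax => ?_⟩
  · rintro ⟨B, r'⟩ hB
    have hexpand (i : Fin K) : Uᴴ * (U * B i * Uᴴ) * U = B i := by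
      rw [Matrix.mul_assoc U, ← Matrix.mul_assoc, hU, Matrix.one_mul, Matrix.mul_assoc, hU,
        Matrix.mul_one]
    refine hmax (a := (fun i => U * B i * Uᴴ, r')) <| (mem_wsrFeasible_mulVec_iff fun i =>
      (hB.2.2 i).mul_mul_conjTranspose_same U).2 ?_
    simpa only [hexpand] using hB
  · rintro ⟨S', r'⟩ hS'
    exact hmax ((mem_wsrFeasible_mulVec_iff hS'.2.2).1 hS')

end Compression

lemma star_dotProduct_eq_zero_of_sum_vecMulVec_mulVec_eq_zero {ι κ : Type*} [Fintype ι] [Fintype κ]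
    {h : κ → ι → ℂ} {x : ι → ℂ} (hx : (∑ k, vecMulVec (h k) (star (h k))) *ᵥ x = 0) (k : κ) :
    star x ⬝ᵥ h k = 0 := by
  have hsum : ∑ k, ‖star x ⬝ᵥ h k‖ ^ 2 = 0 := by
    simp_rw [← rxPower_vecMulVec_star_self, ← rxPower_sum, rxPower, hx, dotProduct_zero,
      Complex.zero_re]
  simpa using
    (Finset.sum_eq_zero_iff_of_nonneg fun k _ => sq_nonneg _).1 hsum k (Finset.mem_univ k)

namespace IsSplitSVD

variable {ι μ ν : Type*} [Fintype ι] [Fintype μ] [Fintype ν] [DecidableEq ι] [DecidableEq μ]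
  [DecidableEq ν] {A : Matrix ι ι ℂ} {U₁ : Matrix ι μ ℂ} {U₂ : Matrix ι ν ℂ}

lemma mul_conjTranspose_add (hU : IsSplitSVD A U₁ U₂) : U₁ * U₁ᴴ + U₂ * U₂ᴴ = 1 := by
  rw [← hU.1, conjTranspose_fromCols_eq_fromRows_conjTranspose, fromCols_mul_fromRows]

lemma orthonormal (hU : IsSplitSVD A U₁ U₂) :
    U₁ᴴ * U₁ = 1 ∧ U₁ᴴ * U₂ = 0 ∧ U₂ᴴ * U₁ = 0 ∧ U₂ᴴ * U₂ = 1 := by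
  rw [← fromBlocks_inj, fromBlocks_one, ← fromRows_mul_fromCols,
    ← conjTranspose_fromCols_eq_fromRows_conjTranspose, hU.2.1]

lemma exists_diagonal (hU : IsSplitSVD A U₁ U₂) :
    ∃ d : μ → ℝ, (∀ i, 0 < d i) ∧ U₁ᴴ * A * U₁ = diagonal (fun i => (d i : ℂ)) ∧
      A = U₁ * diagonal (fun i => (d i : ℂ)) * U₁ᴴ := by
  obtain ⟨d, hd, hA⟩ := hU.2.2
  rw [conjTranspose_fromCols_eq_fromRows_conjTranspose, ← fromBlocks_diagonal,
    fromCols_mul_fromBlocks, fromCols_mul_fromRows] at hA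
  simp only [Matrix.mul_zero, add_zero, diagonal_zero, Matrix.zero_mul] at hA
  refine ⟨d, hd, ?_, hA⟩
  rw [hA, Matrix.mul_assoc U₁, ← Matrix.mul_assoc, hU.orthonormal.1, Matrix.one_mul,
    Matrix.mul_assoc, hU.orthonormal.1, Matrix.mul_one]

lemma posDef_compress (hU : IsSplitSVD A U₁ U₂) : (U₁ᴴ * A * U₁).PosDef := by
  obtain ⟨d, hd, hdiag, -⟩ := hU.exists_diagonal
  rw [hdiag]
  exact PosDef.diagonal fun i => by exact_mod_cast hd i

lemma mul_compress_mul (hU : IsSplitSVD A U₁ U₂) : U₁ * (U₁ᴴ * A * U₁) * U₁ᴴ = A := by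
  obtain ⟨d, -, hdiag, hA⟩ := hU.exists_diagonal
  rw [hdiag, ← hA]

lemma mulVec_mulVec_eq_zero (hU : IsSplitSVD A U₁ U₂) (y : ν → ℂ) : A *ᵥ U₂ *ᵥ y = 0 := by
  rw [← hU.mul_compress_mul, mulVec_mulVec, Matrix.mul_assoc, hU.orthonormal.2.1, Matrix.mul_zero,
    zero_mulVec]

lemma mulVec_conjTranspose_mulVec_eq (hU : IsSplitSVD A U₁ U₂) {g : ι → ℂ}
    (hg : ∀ x, A *ᵥ x = 0 → star x ⬝ᵥ g = 0) : U₁ *ᵥ U₁ᴴ *ᵥ g = g := by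
  have hU₂ : U₂ᴴ *ᵥ g = 0 := by
    rw [← dotProduct_star_self_eq_zero, dotProduct_mulVec, ← star_mulVec]
    exact hg _ (hU.mulVec_mulVec_eq_zero _)
  conv_rhs => rw [← one_mulVec g, ← hU.mul_conjTranspose_add]
  rw [add_mulVec, ← mulVec_mulVec, ← mulVec_mulVec, hU₂, mulVec_zero, add_zero]

lemma eq_sum_blocks (hU : IsSplitSVD A U₁ U₂) {S : Matrix ι ι ℂ} (hS : S.IsHermitian) :
    S = U₁ * (U₁ᴴ * S * U₁) * U₁ᴴ + U₁ * (U₁ᴴ * S * U₂) * U₂ᴴ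
      + U₂ * (U₁ᴴ * S * U₂)ᴴ * U₁ᴴ + U₂ * (U₂ᴴ * S * U₂) * U₂ᴴ := by
  have hone : S = (U₁ * U₁ᴴ + U₂ * U₂ᴴ) * S * (U₁ * U₁ᴴ + U₂ * U₂ᴴ) := by
    rw [hU.mul_conjTranspose_add, Matrix.one_mul, Matrix.mul_one]
  conv_lhs => rw [hone]
  simp only [conjTranspose_mul, conjTranspose_conjTranspose, hS.eq, Matrix.add_mul,
    Matrix.mul_add, Matrix.mul_assoc]
  abel

lemma compress_sum_blocks (hU : IsSplitSVD A U₁ U₂) (B : Matrix μ μ ℂ)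
    (C : Matrix μ ν ℂ) (C' : Matrix ν μ ℂ) (D : Matrix ν ν ℂ) :
    U₁ᴴ * (U₁ * B * U₁ᴴ + U₁ * C * U₂ᴴ + U₂ * C' * U₁ᴴ + U₂ * D * U₂ᴴ) * U₁ = B := by
  obtain ⟨h11, h12, h21, -⟩ := hU.orthonormal
  simp only [Matrix.mul_add, Matrix.add_mul, ← Matrix.mul_assoc, h11, h12, Matrix.zero_mul,
    Matrix.one_mul, add_zero]
  simp only [Matrix.mul_assoc, h11, h21, Matrix.mul_zero, Matrix.mul_one, add_zero]

variable {K : ℕ} {α : Fin K → ℝ} {nv P : ℝ} {h : Fin K → ι → ℂ} {S : Fin K → Matrix ι ι ℂ}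
  {r : Fin K → ℝ}

lemma isWsrOptimal_iff_compress (hU : IsSplitSVD A U₁ U₂)
    (hh : ∀ i, U₁ *ᵥ U₁ᴴ *ᵥ h i = h i) (hS : ∀ i, (S i).PosSemidef) :
    IsWsrOptimal α (bcRegion nv h) A P (S, r) ↔
      IsWsrOptimal α (bcRegion nv fun i => U₁ᴴ *ᵥ h i) (U₁ᴴ * A * U₁) P
        (fun i => U₁ᴴ * S i * U₁, r) := by
  rw [← isWsrOptimal_mulVec_iff hU.orthonormal.1 hS, hU.mul_compress_mul, funext hh]

lemma isWsrOptimal_iff_exists_blocks (hU : IsSplitSVD A U₁ U₂)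
    (hh : ∀ i, U₁ *ᵥ U₁ᴴ *ᵥ h i = h i) :
    IsWsrOptimal α (bcRegion nv h) A P (S, r) ↔
      ∃ (B : Fin K → Matrix μ μ ℂ) (C : Fin K → Matrix μ ν ℂ) (D : Fin K → Matrix ν ν ℂ),
        IsWsrOptimal α (bcRegion nv fun i => U₁ᴴ *ᵥ h i) (U₁ᴴ * A * U₁) P (B, r) ∧
        ∀ i, S i = U₁ * B i * U₁ᴴ + U₁ * C i * U₂ᴴ + U₂ * (C i)ᴴ * U₁ᴴ + U₂ * D i * U₂ᴴ ∧
          (S i).PosSemidef := by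
  constructor
  · intro hopt
    have hS := hopt.1.2.2
    exact ⟨_, fun i => U₁ᴴ * S i * U₂, fun i => U₂ᴴ * S i * U₂,
      (hU.isWsrOptimal_iff_compress hh hS).1 hopt, fun i => ⟨hU.eq_sum_blocks (hS i).1, hS i⟩⟩
  · rintro ⟨B, C, D, hopt, hSB⟩
    have hcompress : (fun i => U₁ᴴ * S i * U₁) = B := by
      funext i
      rw [(hSB i).1, hU.compress_sum_blocks]
    rwa [hU.isWsrOptimal_iff_compress hh fun i => (hSB i).2, hcompress]

end IsSplitSVD

end MISOBC

theorem lemma3p3 {N K m : ℕ} (σ : ℝ) (hσ : 0 < σ)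
    (α : Fin K → ℝ) (hα : ∀ i, 0 < α i)
    (h : Fin K → Fin N → ℂ)
    (A : Matrix (Fin N) (Fin N) ℂ) (hA : A.PosSemidef)
    (hnull : ∀ x : Fin N → ℂ, A.mulVec x = 0 →
      (∑ i, Matrix.vecMulVec (h i) (star (h i))).mulVec x = 0)
    (P : ℝ) (hP : 0 ≤ P) (hm : A.rank = m)
    (U₁ : Matrix (Fin N) (Fin m) ℂ) (U₂ : Matrix (Fin N) (Fin (N - m)) ℂ)
    (hU : MISOBC.IsSplitSVD A U₁ U₂)
    (h' : Fin K → Fin m → ℂ) (hh' : ∀ i, h' i = U₁.conjTranspose.mulVec (h i))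
    (A' : Matrix (Fin m) (Fin m) ℂ) (hA' : A' = U₁.conjTranspose * A * U₁) :
    -- the reduced matrix has full rank
    A'.PosDef ∧
    -- the reduced problem has a solution
    (∃ x, MISOBC.IsWsrOptimal α (MISOBC.bcRegion (σ ^ 2) h') A' P x) ∧
    -- the block form of the optimal covariances, with all admissible off-diagonal blocks
    (∀ (S : Fin K → Matrix (Fin N) (Fin N) ℂ) (r : Fin K → ℝ),
      MISOBC.IsWsrOptimal α (MISOBC.bcRegion (σ ^ 2) h) A P (S, r) ↔
        ∃ (B : Fin K → Matrix (Fin m) (Fin m) ℂ)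
          (C : Fin K → Matrix (Fin m) (Fin (N - m)) ℂ)
          (D : Fin K → Matrix (Fin (N - m)) (Fin (N - m)) ℂ),
          MISOBC.IsWsrOptimal α (MISOBC.bcRegion (σ ^ 2) h') A' P (B, r) ∧
          ∀ i, S i = U₁ * B i * U₁.conjTranspose + U₁ * C i * U₂.conjTranspose
              + U₂ * (C i).conjTranspose * U₁.conjTranspose + U₂ * D i * U₂.conjTranspose ∧
            (S i).PosSemidef) ∧
    -- uniqueness in the reduced problem for pairwise different weights
    ((∃ i, h i ≠ 0) → Function.Injective α →
      ∃! x, MISOBC.IsWsrOptimal α (MISOBC.bcRegion (σ ^ 2) h') A' P x) ∧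
    -- uniqueness for arbitrary weights and an encoding order that sorts them
    ((∀ c : ℝ, LinearIndependent ℝ
        (fun i : {i : Fin K // α i = c} => Matrix.vecMulVec (h' i) (star (h' i)))) →
      ∀ π : Equiv.Perm (Fin K), Antitone (α ∘ π) →
        ∃! x, MISOBC.IsWsrOptimal α (MISOBC.orderRegion (σ ^ 2) h' π) A' P x) ∧
    -- all solutions of the reduced problem have rank at most one
    ((∃ i, h i ≠ 0) → ∀ B r,
      MISOBC.IsWsrOptimal α (MISOBC.bcRegion (σ ^ 2) h') A' P (B, r) → ∀ i, (B i).rank ≤ 1) ∧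
    -- the reduced problem is solved through its dual multiple access channel
    (∀ π : Equiv.Perm (Fin K), Antitone (α ∘ π) →
      (∃ p, MISOBC.IsMacOptimal α (σ ^ 2) A' h' P π p) ∧
      ∀ p, MISOBC.IsMacOptimal α (σ ^ 2) A' h' P π p →
        ∃ q : Fin K → ℝ, (∀ i, 0 ≤ q i) ∧
          MISOBC.IsDownlinkPower (σ ^ 2) A' h' π p q ∧
          MISOBC.macRate A' h' π p
            ∈ MISOBC.orderRegion (σ ^ 2) h' π (MISOBC.beamCov A' h' π p q) ∧
          MISOBC.IsWsrOptimal α (MISOBC.bcRegion (σ ^ 2) h') A' P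
            (MISOBC.beamCov A' h' π p q, MISOBC.macRate A' h' π p)) := by
  obtain rfl : h' = fun i => U₁.conjTranspose.mulVec (h i) := funext hh'
  subst hA'
  have hnv : 0 < σ ^ 2 := by positivity
  have hα0 : ∀ i, 0 ≤ α i := fun i => (hα i).le
  have hpd := hU.posDef_compress
  have hrange : ∀ i, U₁.mulVec (U₁.conjTranspose.mulVec (h i)) = h i := fun i =>
    hU.mulVec_conjTranspose_mulVec_eq fun x hx =>
      MISOBC.star_dotProduct_eq_zero_of_sum_vecMulVec_mulVec_eq_zero (hnull x hx) i
  have hne : (∃ i, h i ≠ 0) → ∃ i, U₁.conjTranspose.mulVec (h i) ≠ 0 :=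
    Exists.imp fun i hi h0 => hi (by rw [← hrange i, h0, Matrix.mulVec_zero])
  refine ⟨hpd, ?_, fun S r => hU.isWsrOptimal_iff_exists_blocks hrange,
    fun hh => MISOBC.existsUnique_isWsrOptimal_bcRegion hα hnv hpd hP (hne hh),
    fun hind _ => MISOBC.existsUnique_isWsrOptimal_orderRegion hα hnv hpd hP hind,
    fun hh B r hopt => hopt.rank_le_one hα hnv hpd hP (hne hh), fun π hπ => ?_⟩
  · obtain ⟨π, hπ⟩ := MISOBC.exists_antitone_comp_perm α
    exact MISOBC.exists_isWsrOptimal hα0 hnv hpd hP hπ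
      (MISOBC.orderRegion_subset_bcRegion _ _ π) fun _ => subset_rfl
  · refine ⟨MISOBC.exists_isMacOptimal α hnv hpd _ hP π, fun p hp => ?_⟩
    obtain ⟨q, hq, hdown⟩ := MISOBC.exists_isDownlinkPower hnv.le hpd _ π hp.1.1
    exact ⟨q, hq, hdown, hdown.macRate_mem_orderRegion hnv hpd hp.1.1 hq,
      hp.isWsrOptimal hα0 hnv hpd hπ (MISOBC.orderRegion_subset_bcRegion _ _ π)
        (fun _ => subset_rfl) hq hdown⟩
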